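/- **Setting.** Let $(X,d)$ be a finite metric space of doubling dimension at most $k$, $k\ge 1$ real (every ball of radius $2\rho>0$ is covered by at most $2^k$ balls of radius $\rho$), with interpoint distances at least $1$. Let $0<\varepsilon\le 1$, let $n$ be a size parameter, $s=(\log n)^{c/k}\ge 4$ with a constant $0<c<1$, and $1\le L\le O(\log_s n)$. Let $N_L\subseteq\dots\subseteq N_1\subseteq N_0=N_{-1}=\dots=X$ with $|N_L|=1$, where for $1\le i\le L$ the set $N_i$ is an $s^i$-net of $X$ (distinct points of $N_i$ are at distance $>s^i$, and every point of $X$ is within $s^i$ of $N_i$). In the net tree, the parent of the node $(u,i)$, $u\in N_i$, $i<L$, is $(v,i+1)$ with $v$ a closest point of $N_{i+1}$ to $u$, ties broken arbitrarily; $\mathrm{Anc}_j(u)$ is the height-$j$ ancestor of $(u,0)$, and $\mathrm{Anc}_j(u)=(u,0)$ for $j<0$. *Solutions.* An instance consists of a set of at most $n$ terminals of $X$ with non-negative penalties. A solution is a finite multigraph on $X$: an Eulerian one (its edges form one closed walk) for the prize collecting TSP, a connected one for the prize collecting Steiner tree problem; it has no self-loops, except that it may be a single self-loop. Its weight $w$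 is the total length of its edges, and its cost is $w$ plus the penalties of the unvisited terminals. A multigraph is *net-respecting* if every edge $\{x,y\}$ has both ends in $N_i$, where $s^i\le\varepsilon d(x,y)<s^{i+1}$, $i\in\mathbb Z$. It is *$q$-sparse* if for all $1\le i\le L$ and $u\in N_i$ its edges with both ends in $B(u,3s^i)$ have total weight at most $qs^i$. *Hierarchical decomposition.* Let $\chi=b^k$, $b>1$ a constant. For each $0\le i\le L$ and $u\in N_i$ sample independently $h^{(i)}_u\in[0,s^i]$ with density $\frac{\chi}{\chi-1}\frac{\ln\chi}{s^i}e^{-t\ln\chi/s^i}$, and put $r^{(i)}_u=s^i+h^{(i)}_u$. Fix an arbitrary ordering of each $N_i$; the partition $\Pi_i$ of $X$ puts a point into the cluster of the first $u\in N_i$ whose ball $B(u,r^{(i)}_u)$ contains it. The height-$i$ clusters, $0\le i\le L-1$, are the blocks of the common refinement of $\Pi_i,\dots,\Pi_{L-1}$; the parent of a height-$i$ cluster is the height-$(i+1)$ cluster containing it, or the whole space if $i=L-1$. The portals of a height-$i$ cluster $C$ are the nodes $\mathrm{Anc}_j(u)$, $u\in C$, where $s^j\le\theta s^i<s^{j+1}$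 and $\theta=\Theta(\frac{\varepsilon}{kL})$, $\theta\le \frac{\varepsilon}{kL}$; a portal is considered together with the cluster to which it is assigned. A multigraph on portals is *portal-respecting* if each edge joins portals of two clusters (possibly equal) of the same height with the same parent, or a portal of a cluster and a portal of one of its children. A portal of $C$ is *active* if it is joined to a portal of a sibling or of the parent of $C$. The multigraph is *$(m,r)$-light* if it is portal-respecting and each cluster has at most $m$ portals and at most $r$ active portals. It visits a point $t$ if it covers a node $(t,j)$ for some $j$; its weight is that of the induced multigraph on $X$. *Good-radius event.* $\mathcal A$ is the event that for all $1\le i\le L$ and all $u\in N_i$ the ball $B(u,r^{(i)}_u)$ cuts (contains exactly one endpoint of) at most $a\,qk$ edges of $T$ of length at most $s^i$, counted with multiplicity, where $a$ is a constant. **Theorem (Sparse Structural Property).** There is a universal $b_0>1$ such that for every $b\ge b_0$ there is an $a_0>0$ such that for every $a\ge a_0$, every $c\in(0,1)$, and every choice of the constants in $L=O(\log_s n)$ and $\theta=\Theta(\frac{\varepsilon}{kL})$, there are constants $C_1,C_2,C_3,C_4>0$, depending only on these constants, for which the following holds for all $0<\varepsilon\le1$ and all $n\ge n_0(\varepsilon)$.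 Let $$m=\Big(C_1\frac{kLs}{\varepsilon}\Big)^k,\qquad r=q\,C_2^k+\Big(C_3\frac{s}{\varepsilon}\Big)^k .$$ In the setting above, suppose that $T$ is an optimal (minimum cost) net-respecting solution of either problem and that $T$ is $q$-sparse. Then to every hierarchical decomposition (every choice of radii) one can associate a connected multigraph $T'$ on portals which is $(m,r)$-light for that decomposition and visits every terminal that $T$ visits, such that $T'$ is Eulerian if $T$ is, and $$\Pr\big[\,w(T')\le(1+C_4\varepsilon)\,w(T)\,\big|\,\mathcal A\,\big]\ \ge\ \tfrac14 ,$$ where the probability is over the random radii. -/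

import Mathlib

open MeasureTheory ProbabilityTheory

universe u v

noncomputable section

namespace SparseStruct

/-! ### Metric notions -/

/-- Doubling dimension at most `k`: every ball of radius `2ρ` is covered by at most `2 ^ k` balls of
radius `ρ`. -/
def DoublingDimLE (X : Type u) [MetricSpace X] (k : ℝ) : Prop :=
  ∀ (x : X) (ρ : ℝ), 0 < ρ → ∃ Z : Finset X, (Z.card : ℝ) ≤ (2 : ℝ) ^ k ∧
    Metric.closedBall x (2 * ρ) ⊆ ⋃ z ∈ Z, Metric.closedBall z ρ

/-- Distinct points of `S` are at distance more than `ρ`. -/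
def IsPacking {X : Type u} [MetricSpace X] (ρ : ℝ) (S : Set X) : Prop :=
  ∀ x ∈ S, ∀ y ∈ S, x ≠ y → ρ < dist x y

/-- Every point of `Z` is within distance `ρ` of some point of `S`. -/
def IsCovering {X : Type u} [MetricSpace X] (ρ : ℝ) (S Z : Set X) : Prop :=
  ∀ z ∈ Z, ∃ x ∈ S, dist x z ≤ ρ

/-- `S` is a `ρ`-net for `Z`. -/
def IsNet {X : Type u} [MetricSpace X] (ρ : ℝ) (S Z : Set X) : Prop :=
  S ⊆ Z ∧ IsPacking ρ S ∧ IsCovering ρ S Z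

/-! ### Finite multigraphs, given by their multiset of edges -/

/-- A multigraph on `V`: a multiset of unordered pairs (self-loops are diagonal pairs). -/
abbrev MGraph (V : Type v) : Type v := Multiset (Sym2 V)

/-- The vertices visited by a multigraph. -/
def verts {V : Type v} (F : MGraph V) : Set V := {x | ∃ e ∈ F, x ∈ e}

/-- The multigraph is non-empty and connected on the vertices that it visits. -/
def IsConn {V : Type v} (F : MGraph V) : Prop :=
  F ≠ 0 ∧ ∀ x ∈ verts F, ∀ y ∈ verts F, Relation.ReflTransGen (fun a b => s(a, b) ∈ F) x y

/-- The edges of the closed walk `x₀, x₁, …, xₘ, x₀` (for a single point, one self-loop). -/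
def closedWalkEdges {V : Type v} (l : List V) : MGraph V :=
  (List.zipWith (fun a b => s(a, b)) l (l.rotate 1) : List (Sym2 V))

/-- The multigraph is Eulerian: its edges, with multiplicity, are exactly those of one closed
walk (a circuit). -/
def IsEulerian {V : Type v} (F : MGraph V) : Prop :=
  ∃ l : List V, l ≠ [] ∧ F = closedWalkEdges l

/-- Length of an edge. -/
def edgeLen {X : Type u} [MetricSpace X] : Sym2 X → ℝ :=
  Sym2.lift ⟨fun x y => dist x y, fun x y => dist_comm x y⟩

/-- Weight of a multigraph. -/
def weight {X : Type u} [MetricSpace X] (F : MGraph X) : ℝ := (F.map edgeLen).sum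

/-! ### The prize collecting problems -/

/-- Prize collecting travelling salesman, and prize collecting Steiner tree. -/
inductive Kind where
  | tsp
  | stp

/-- Terminals with their penalties. -/
structure PCInstance (X : Type u) where
  terminals : Finset X
  penalty : X → NNReal

/-- Feasible solutions: a circuit (`tsp`), or a connected multigraph (`stp`); without self-loops,
unless the solution is a single self-loop. -/
def Feasible {X : Type u} (K : Kind) (F : MGraph X) : Prop :=
  ((∀ e ∈ F, ¬ e.IsDiag) ∨ ∃ x : X, F = {s(x, x)}) ∧
  match K with
  | Kind.tsp => IsEulerian F
  | Kind.stp => IsConn F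

open Classical in
/-- Weight of the edges plus the penalties of the terminals that are not visited. -/
def cost {X : Type u} [MetricSpace X] (I : PCInstance X) (F : MGraph X) : ℝ :=
  weight F + ∑ t ∈ I.terminals.filter (fun t => t ∉ verts F), (I.penalty t : ℝ)

/-! ### Hierarchical nets and the net tree -/

/-- Hierarchical nets `N L ⊆ ⋯ ⊆ N 1 ⊆ N 0 = X` (at heights `i ≤ 0` the net is `N 0 = X`), with
`N L` a single point, and the parent function of a net tree: the parent of the node `(u, i)`
is `(par i u, i + 1)`, with `par i u` a closest point of `N (i + 1)` (ties broken arbitrarily). -/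
structure NetTree (X : Type u) [MetricSpace X] [Fintype X] (s : ℝ) (L : ℕ) where
  N : ℕ → Finset X
  N_zero : N 0 = Finset.univ
  nested : ∀ i < L, N (i + 1) ⊆ N i
  net : ∀ i, 1 ≤ i → i ≤ L → IsNet (s ^ i) (N i : Set X) Set.univ
  top : (N L).card = 1
  par : ℕ → X → X
  par_mem : ∀ i < L, ∀ u ∈ N i, par i u ∈ N (i + 1)
  par_closest : ∀ i < L, ∀ u ∈ N i, ∀ v ∈ N (i + 1), dist u (par i u) ≤ dist u v

namespace NetTree

variable {X : Type u} [MetricSpace X] [Fintype X] {s : ℝ} {L : ℕ} (H : NetTree X s L)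

/-- The point of the height-`j` ancestor of the node `(u, 0)`. -/
def anc : ℕ → X → X
  | 0, x => x
  | j + 1, x => H.par j (anc j x)

/-- Every edge `{x, y}` has both endpoints in `N i`, where `s ^ i ≤ ε d(x, y) < s ^ (i + 1)`. The
height `i` may be negative, where the net is `N 0 = X`. -/
def NetRespecting (ε : ℝ) (F : MGraph X) : Prop :=
  ∀ e ∈ F, ∀ i : ℤ, s ^ i ≤ ε * edgeLen e → ε * edgeLen e < s ^ (i + 1) →
    ∀ x ∈ e, x ∈ H.N i.toNat

/-- An optimal net-respecting solution. -/
def OptNetRespecting (K : Kind) (I : PCInstance X) (ε : ℝ) (F : MGraph X) : Prop :=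
  Feasible K F ∧ H.NetRespecting ε F ∧
    ∀ F' : MGraph X, Feasible K F' → H.NetRespecting ε F' → cost I F ≤ cost I F'

open Classical in
/-- `w(F|_{B(u, 3 s ^ i)}) ≤ q s ^ i` for all `1 ≤ i ≤ L` and `u ∈ N i`, where `F|_S` consists of the
edges with both endpoints in `S`. -/
def Sparse (q : ℝ) (F : MGraph X) : Prop :=
  ∀ i, 1 ≤ i → i ≤ L → ∀ u ∈ H.N i,
    weight (F.filter (fun e => ∀ x ∈ e, x ∈ Metric.closedBall u (3 * s ^ i))) ≤ q * s ^ i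

/-! ### Hierarchical decompositions -/

/-- The index set of the random radii: heights `0 ≤ i ≤ L` and net points `u ∈ N i`. -/
abbrev Idx : Type u := Σ i : Fin (L + 1), {x : X // x ∈ H.N i}

open Classical in
/-- Radius of the ball at `(i, u)`, for the sampled values `h`: `s ^ i + h_u` (only meaningful for
`i ≤ L` and `u ∈ N i`). -/
def radius (h : H.Idx → ℝ) (i : ℕ) (u : X) : ℝ :=
  if hi : i < L + 1 then
    if hu : u ∈ H.N i then s ^ i + h ⟨⟨i, hi⟩, ⟨u, hu⟩⟩ else s ^ i
  else s ^ i

/-- The sampled values lie in the support `[0, s ^ i]` of the truncated exponential law. -/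
def Admissible (h : H.Idx → ℝ) : Prop := ∀ p : H.Idx, h p ∈ Set.Icc 0 (s ^ (p.1 : ℕ))

/-- `u` is the first point of `N i`, in the order given by the ranks `ord i`, whose ball contains
`x`; that is, `x` lies in the cluster of `Π i` with center `u`. -/
def IsCenter (ord : ℕ → X → ℕ) (h : H.Idx → ℝ) (i : ℕ) (u x : X) : Prop :=
  u ∈ H.N i ∧ x ∈ Metric.closedBall u (H.radius h i u) ∧
    ∀ v ∈ H.N i, x ∈ Metric.closedBall v (H.radius h i v) → ord i u ≤ ord i v

/-- The height-`i` cluster that contains `x`: the points that no `Π j` with `i ≤ j ≤ L - 1` separates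
from `x`. For `i ≥ L` this is the whole space. -/
def clusterOf (ord : ℕ → X → ℕ) (h : H.Idx → ℝ) (i : ℕ) (x : X) : Set X :=
  {y | ∀ j, i ≤ j → j < L → ∃ u, H.IsCenter ord h j u x ∧ H.IsCenter ord h j u y}

/-- `C` is a height-`i` cluster, `0 ≤ i ≤ L - 1`. -/
def IsCluster (ord : ℕ → X → ℕ) (h : H.Idx → ℝ) (i : ℕ) (C : Set X) : Prop :=
  i < L ∧ ∃ x, C = H.clusterOf ord h i x

end NetTree

/-! ### Portals -/

/-- A node `(x, j)` of the net tree, together with the cluster (and the height of the cluster)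
to which it is assigned as a portal. -/
structure Portal (X : Type u) where
  height : ℕ
  cluster : Set X
  node : X × ℕ

/-- Weight of a multigraph on portals: that of the induced multigraph on points. -/
def portalWeight {X : Type u} [MetricSpace X] (F : MGraph (Portal X)) : ℝ :=
  weight (F.map (Sym2.map (fun p => p.node.1)))

/-- The multigraph covers `(t, j)` for some `j`. -/
def Visits {X : Type u} (F : MGraph (Portal X)) (t : X) : Prop :=
  ∃ p ∈ verts F, p.node.1 = t

namespace NetTree

variable {X : Type u} [MetricSpace X] [Fintype X] {s : ℝ} {L : ℕ} (H : NetTree X s L)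

/-- The portal nodes of a height-`i` cluster `C`: the ancestors `Anc_j(u)`, `u ∈ C`, for the `j` with
`s ^ j ≤ θ s ^ i < s ^ (j + 1)`. For `j < 0` the node `(u, j)` is `(u, 0)`. -/
def portalNodes (θ : ℝ) (i : ℕ) (C : Set X) : Set (X × ℕ) :=
  {p | ∃ j : ℤ, s ^ j ≤ θ * s ^ i ∧ θ * s ^ i < s ^ (j + 1) ∧
    ∃ u ∈ C, p = (H.anc j.toNat u, j.toNat)}

/-- `p` is a portal of a cluster of the hierarchical decomposition. -/
def IsPortal (θ : ℝ) (ord : ℕ → X → ℕ) (h : H.Idx → ℝ) (p : Portal X) : Prop :=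
  H.IsCluster ord h p.height p.cluster ∧ p.node ∈ H.portalNodes θ p.height p.cluster

/-- Two height-`i` clusters have the same parent cluster (at the top height `L - 1` the parent is
the whole space). -/
def SameParent (ord : ℕ → X → ℕ) (h : H.Idx → ℝ) (i : ℕ) (C C' : Set X) : Prop :=
  ∃ x, C ⊆ H.clusterOf ord h (i + 1) x ∧ C' ⊆ H.clusterOf ord h (i + 1) x

/-- All vertices are portals, and every edge joins two portals of the same height whose clusters
have the same parent, or a portal of a cluster and one of a child of that cluster. -/
def PortalRespecting (θ : ℝ) (ord : ℕ → X → ℕ) (h : H.Idx → ℝ) (F : MGraph (Portal X)) : Prop :=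
  (∀ p ∈ verts F, H.IsPortal θ ord h p) ∧
  ∀ p p' : Portal X, s(p, p') ∈ F → p'.height ≤ p.height →
    (p.height = p'.height ∧ H.SameParent ord h p.height p.cluster p'.cluster) ∨
    (p.height = p'.height + 1 ∧ p'.cluster ⊆ p.cluster)

/-- A portal `p` of a cluster `C` is active in `F` if it is joined to a portal of a sibling of `C` or
to a portal of the parent of `C`. -/
def IsActive (ord : ℕ → X → ℕ) (h : H.Idx → ℝ) (F : MGraph (Portal X)) (p : Portal X) : Prop :=
  ∃ p' : Portal X, s(p, p') ∈ F ∧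
    ((p'.height = p.height ∧ p'.cluster ≠ p.cluster ∧
        H.SameParent ord h p.height p.cluster p'.cluster) ∨
      (p'.height = p.height + 1 ∧ p.cluster ⊆ p'.cluster))

/-- `(m, r)`-light: portal-respecting for a hierarchical decomposition in which each cluster has at
most `m` portals and at most `r` active portals. -/
def IsLight (θ : ℝ) (ord : ℕ → X → ℕ) (h : H.Idx → ℝ) (m r : ℝ) (F : MGraph (Portal X)) : Prop :=
  H.PortalRespecting θ ord h F ∧
  ∀ i C, H.IsCluster ord h i C →
    (H.portalNodes θ i C).Finite ∧ ((H.portalNodes θ i C).ncard : ℝ) ≤ m ∧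
    {p : Portal X | p.height = i ∧ p.cluster = C ∧ H.IsActive ord h F p}.Finite ∧
    ({p : Portal X | p.height = i ∧ p.cluster = C ∧ H.IsActive ord h F p}.ncard : ℝ) ≤ r

end NetTree

/-! ### Random radii and the good-radius event -/

/-- The truncated exponential law on `[0, a]`, with density
`t ↦ χ / (χ - 1) * (log χ / a) * exp (- t log χ / a)`. -/
def truncExp (χ a : ℝ) : Measure ℝ :=
  volume.withDensity fun t => ENNReal.ofReal
    ((Set.Icc 0 a).indicator
      (fun t => χ / (χ - 1) * (Real.log χ / a) * Real.exp (-(t * Real.log χ / a))) t)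

namespace NetTree

variable {X : Type u} [MetricSpace X] [Fintype X] {s : ℝ} {L : ℕ} (H : NetTree X s L)

/-- The law of the independent family of values `h_u`; at height `i` they are truncated exponential
on `[0, s ^ i]`. -/
def radiiLaw (χ : ℝ) : Measure (H.Idx → ℝ) :=
  Measure.pi fun p : H.Idx => truncExp χ (s ^ (p.1 : ℕ))

open Classical in
/-- The number, with multiplicity, of edges of length at most `ℓ` in `F` that the ball `B(u, ρ)` cuts
(exactly one endpoint in the ball). -/
def numCut (F : MGraph X) (ℓ : ℝ) (u : X) (ρ : ℝ) : ℕ :=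
  (F.filter fun e => edgeLen e ≤ ℓ ∧
    (∃ x ∈ e, x ∈ Metric.closedBall u ρ) ∧ ∃ y ∈ e, y ∉ Metric.closedBall u ρ).card

/-- The good-radius event: for all `1 ≤ i ≤ L` and `u ∈ N i`, the random ball at `(i, u)` cuts at most
`a` edges of `F` of length at most `s ^ i`. -/
def goodEvent (F : MGraph X) (a : ℝ) : Set (H.Idx → ℝ) :=
  {h | ∀ i, 1 ≤ i → i ≤ L → ∀ u ∈ H.N i, (numCut F (s ^ i) u (H.radius h i u) : ℝ) ≤ a}

end NetTree

end SparseStruct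

end

/-!
Every edge `{x, y}` of `T` is rerouted through portals (`route`): from `x` up through portals of
the clusters of `x` of heights `0, 1, …, κ - 1`, where `κ` is the first height at which `x` and
`y` share a cluster, then across to the cluster of `y`, and down again. Replacing edges by trails
keeps a multigraph connected and Eulerian, so only the weight and the number of active portals
matter.

*Weight.* The partition of height `κ - 1` separates `x` and `y`, and the detour is proportional to
`θ s ^ (κ - 1)` (`portalWeight_route_le`). So it suffices that the partition of height `i`
separates `x` and `y` with conditional probability `O(k) d(x, y) / s ^ i` (`prob_separated_le`):
summing over the `L` heights, with `θ ≤ ε / (k L)`, bounds the expected detours by `O(ε) w(T)`,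
and Markov's inequality applies. The good-radius event is a product event, so the radii remain
independent after conditioning (`cond_pi`). By sparsity the bad radii of a ball at height `i` have
Lebesgue measure at most `s ^ i / (a k)` (`volume_bad_le`), and this is so small compared to the
mean `s ^ i / (k log b)` of the exponential law that the conditioned law is still memoryless up to
constants (`cond_truncExp_Ico_le`). Hence the first ball to reach `x` or `y` is unlikely to cut
between them (`first_hit_le`); the truncation error `1 / χ` per ball is harmless, since at most
`32 ^ k ≤ χ` balls reach `x` or `y`.

*Lightness.* An edge with its merge height `κ` uses the portal next to its own endpoint only at
the topmost `t` heights below `κ`, where `s ^ t ≥ 1 / θ`. Further down it uses a portal shared by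
all such edges, next to a fixed hub of the cluster. That costs
`O(s ^ (κ - 1 - t)) = O(θ s ^ (κ - 1))`, which is of the order of the detour anyway. So besides
its hub a cluster `C` of height `i` has active portals only from edges leaving `C` that are
separated at one of the heights `i, …, i + t - 1` (`activeSet_ncard_le`). At each of these
heights, good radii allow few short edges to be cut by each of the `2 ^ O(k)` balls near `C`; the
longer edges have their ends in a net of mesh about `ε s ^ (i - 1)`, because `T` is
net-respecting. Since `s = (log n) ^ (c / k)`, the number `t` is `O(k)`, which `C₂ ^ k` absorbs.

If some radius is bad, no bound on the weight is needed, and all edges are routed through hubs.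
-/

namespace SparseStruct

/-! ### Trails in multigraphs -/

section Trail

variable {V : Type u} {W : Type v}

/-- `Trail a b F`: the edges of `F`, with multiplicity, are those of one walk from `a` to `b`. -/
inductive Trail : V → V → MGraph V → Prop
  | nil (a : V) : Trail a a 0
  | cons {a b c : V} {F : MGraph V} : Trail b c F → Trail a c (s(a, b) ::ₘ F)

lemma Trail.single (a b : V) : Trail a b {s(a, b)} :=
  Trail.cons (Trail.nil b)

lemma Trail.trans {a b c : V} {F G : MGraph V} (h : Trail a b F) (h' : Trail b c G) :
    Trail a c (F + G) := by
  induction h with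
  | nil a => simpa using h'
  | cons _ ih => rw [Multiset.cons_add]; exact Trail.cons (ih h')

lemma Trail.symm {a b : V} {F : MGraph V} (h : Trail a b F) : Trail b a F := by
  induction h with
  | nil a => exact Trail.nil a
  | @cons a b c F _ ih =>
    have := ih.trans (Trail.single b a)
    rwa [add_comm, Multiset.singleton_add, Sym2.eq_swap] at this

/-- Two vertices are joined by a path with edges in `F`. -/
abbrev Reach (F : MGraph V) : V → V → Prop :=
  Relation.ReflTransGen (fun a b => s(a, b) ∈ F)

lemma Reach.symm {F : MGraph V} {x y : V} (h : Reach F x y) : Reach F y x := by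
  induction h with
  | refl => exact .refl
  | tail _ hbc ih => exact .head (by rwa [Sym2.eq_swap]) ih

lemma Reach.mono {F G : MGraph V} (hFG : F ≤ G) {x y : V} (h : Reach F x y) : Reach G x y :=
  Relation.ReflTransGen.mono (fun _ _ hab => Multiset.mem_of_le hFG hab) _ _ h

lemma Trail.reach {a b : V} {F : MGraph V} (h : Trail a b F) :
    Reach F a b ∧ ∀ x ∈ verts F, Reach F a x := by
  induction h with
  | nil a => exact ⟨.refl, by rintro x ⟨e, he, -⟩; simp at he⟩
  | @cons a b c F _ ih =>
    have hle : F ≤ s(a, b) ::ₘ F := Multiset.le_cons_self _ _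
    have hab : Reach (s(a, b) ::ₘ F) a b := .single (Multiset.mem_cons_self _ _)
    refine ⟨hab.trans (ih.1.mono hle), ?_⟩
    rintro x ⟨e, he, hx⟩
    rcases Multiset.mem_cons.1 he with rfl | he
    · rcases Sym2.mem_iff.1 hx with rfl | rfl
      · exact .refl
      · exact hab
    · exact hab.trans ((ih.2 x ⟨e, he, hx⟩).mono hle)

lemma Trail.isConn {a b : V} {F : MGraph V} (h : Trail a b F) (hF : F ≠ 0) : IsConn F :=
  ⟨hF, fun x hx y hy => (h.reach.2 x hx).symm.trans (h.reach.2 y hy)⟩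

lemma trail_zipWith (a b : V) (l : List V) :
    Trail a b (List.zipWith (fun a b => s(a, b)) (a :: l) (l ++ [b]) : List (Sym2 V)) := by
  induction l generalizing a with
  | nil => exact Trail.single a b
  | cons c l ih => exact Trail.cons (ih c)

lemma Trail.eq_of_eq_zero {a b : V} {F : MGraph V} (h : Trail a b F) (hF : F = 0) : a = b := by
  induction h with
  | nil a => rfl
  | cons _ _ => exact absurd hF (Multiset.cons_ne_zero)

lemma Trail.exists_zipWith {a b : V} {F : MGraph V} (h : Trail a b F) (hF : F ≠ 0) :
    ∃ l : List V, F = (List.zipWith (fun a b => s(a, b)) (a :: l) (l ++ [b]) : List (Sym2 V)) := by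
  induction h with
  | nil a => exact absurd rfl hF
  | @cons a b c F h ih =>
    by_cases hF0 : F = 0
    · obtain rfl := h.eq_of_eq_zero hF0
      exact ⟨[], by rw [hF0]; rfl⟩
    · obtain ⟨l, hl⟩ := ih hF0
      exact ⟨b :: l, by rw [hl]; rfl⟩

/-- A multigraph is Eulerian iff it is the non-empty edge set of a closed trail. -/
lemma isEulerian_iff {F : MGraph V} : IsEulerian F ↔ F ≠ 0 ∧ ∃ a, Trail a a F := by
  constructor
  · rintro ⟨l, hl, rfl⟩
    obtain ⟨a, l, rfl⟩ := List.exists_cons_of_ne_nil hl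
    refine ⟨?_, a, ?_⟩
    · intro h
      have := congrArg Multiset.card h
      simp [closedWalkEdges] at this
    · simpa [closedWalkEdges] using trail_zipWith a a l
  · rintro ⟨hF, a, h⟩
    obtain ⟨l, hl⟩ := h.exists_zipWith hF
    exact ⟨a :: l, by simp, by rw [hl]; simp [closedWalkEdges]⟩

lemma IsEulerian.isConn {F : MGraph V} (h : IsEulerian F) : IsConn F := by
  obtain ⟨hF, a, ha⟩ := isEulerian_iff.1 h
  exact ha.isConn hF

/-! ### Replacing the edges of a multigraph by trails -/

variable {f : V → W} {R : Sym2 V → MGraph W}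

lemma bind_ne_zero {F : MGraph V} (hF : F ≠ 0) (hne : ∀ e, R e ≠ 0) : F.bind R ≠ 0 := by
  obtain ⟨e, he⟩ := Multiset.exists_mem_of_ne_zero hF
  obtain ⟨e', he'⟩ := Multiset.exists_mem_of_ne_zero (hne e)
  exact fun h => by simpa [h] using Multiset.mem_bind.2 ⟨e, he, he'⟩

lemma Trail.bind (hR : ∀ x y, Trail (f x) (f y) (R s(x, y))) {a b : V} {F : MGraph V}
    (h : Trail a b F) : Trail (f a) (f b) (F.bind R) := by
  induction h with
  | nil a => exact Trail.nil _
  | @cons a b c F _ ih => rw [Multiset.cons_bind]; exact (hR a b).trans ih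

lemma IsEulerian.bind (hR : ∀ x y, Trail (f x) (f y) (R s(x, y))) (hne : ∀ e, R e ≠ 0)
    {F : MGraph V} (h : IsEulerian F) : IsEulerian (F.bind R) := by
  obtain ⟨hF, a, ha⟩ := isEulerian_iff.1 h
  exact isEulerian_iff.2 ⟨bind_ne_zero hF hne, f a, ha.bind hR⟩

lemma IsConn.bind (hR : ∀ x y, Trail (f x) (f y) (R s(x, y))) (hne : ∀ e, R e ≠ 0)
    {F : MGraph V} (h : IsConn F) : IsConn (F.bind R) := by
  have hle : ∀ e ∈ F, R e ≤ F.bind R := fun e he => Multiset.le_bind _ he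
  -- every vertex of the new multigraph reaches the image of a vertex of the old one
  have key : ∀ p ∈ verts (F.bind R), ∃ x ∈ verts F, Reach (F.bind R) (f x) p := by
    rintro p ⟨e', he', hp⟩
    obtain ⟨e, he, hee⟩ := Multiset.mem_bind.1 he'
    induction e with
    | _ x y =>
      exact ⟨x, ⟨_, he, Sym2.mem_mk_left x y⟩,
        ((hR x y).reach.2 p ⟨e', hee, hp⟩).mono (hle _ he)⟩
  have lift : ∀ x y, Reach F x y → Reach (F.bind R) (f x) (f y) := by
    intro x y hxy
    induction hxy with
    | refl => exact .refl
    | tail _ hbc ih => exact ih.trans ((hR _ _).reach.1.mono (hle _ hbc))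
  refine ⟨bind_ne_zero h.1 hne, fun p hp p' hp' => ?_⟩
  obtain ⟨x, hx, hxp⟩ := key p hp
  obtain ⟨y, hy, hyp⟩ := key p' hp'
  exact hxp.symm.trans ((lift x y (h.2 x hx y hy)).trans hyp)

end Trail

/-! ### Packings in doubling spaces -/

section Packing

variable {X : Type u} [MetricSpace X]

/-- Iterating the doubling property `m` times. -/
lemma DoublingDimLE.exists_cover {k : ℝ} (hX : DoublingDimLE X k) (m : ℕ) :
    ∀ (x : X) (ρ : ℝ), 0 < ρ → ∃ Z : Finset X, (Z.card : ℝ) ≤ ((2 : ℝ) ^ k) ^ m ∧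
      Metric.closedBall x (2 ^ m * ρ) ⊆ ⋃ z ∈ Z, Metric.closedBall z ρ := by
  classical
  induction m with
  | zero => exact fun x ρ _ => ⟨{x}, by simp, by simp⟩
  | succ m ih =>
    intro x ρ hρ
    obtain ⟨Z, hZ, hcov⟩ := ih x (2 * ρ) (by linarith)
    choose g hg hgcov using fun z => hX z ρ hρ
    refine ⟨Z.biUnion g, ?_, ?_⟩
    · calc ((Z.biUnion g).card : ℝ) ≤ ∑ z ∈ Z, ((g z).card : ℝ) := by
            exact_mod_cast Finset.card_biUnion_le
        _ ≤ ∑ z ∈ Z, (2 : ℝ) ^ k := Finset.sum_le_sum fun z _ => hg z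
        _ = Z.card * (2 : ℝ) ^ k := by simp
        _ ≤ ((2 : ℝ) ^ k) ^ (m + 1) := by
            rw [pow_succ]; gcongr
    · intro y hy
      have hy' : y ∈ Metric.closedBall x (2 ^ m * (2 * ρ)) := by
        rwa [← mul_assoc, ← pow_succ]
      obtain ⟨z, hz, hyz⟩ := Set.mem_iUnion₂.1 (hcov hy')
      obtain ⟨w, hw, hyw⟩ := Set.mem_iUnion₂.1 (hgcov z hyz)
      exact Set.mem_iUnion₂.2 ⟨w, Finset.mem_biUnion.2 ⟨z, hz, hw⟩, hyw⟩

/-- A ball of radius `R` contains at most `(4 R / ρ) ^ k` points at mutual distances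
more than `ρ`. -/
lemma DoublingDimLE.card_le {k : ℝ} (hX : DoublingDimLE X k) (hk : 0 ≤ k) {ρ R : ℝ}
    (hρ : 0 < ρ) (hR : ρ ≤ 4 * R) {S : Finset X} (hS : IsPacking ρ (S : Set X)) {x : X}
    (hSx : ∀ y ∈ S, dist y x ≤ R) : (S.card : ℝ) ≤ (4 * R / ρ) ^ k := by
  classical
  have h1 : 1 ≤ 4 * R / ρ := by rw [le_div_iff₀ hρ]; linarith
  -- `2 ^ m` is the power of two with `2 R / ρ ≤ 2 ^ m ≤ 4 R / ρ`
  obtain ⟨m, hm, hm'⟩ := exists_nat_pow_near h1 (one_lt_two)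
  obtain ⟨Z, hZ, hcov⟩ := hX.exists_cover m x (ρ / 2) (by linarith)
  have hR' : R ≤ 2 ^ m * (ρ / 2) := by
    rw [div_lt_iff₀ hρ, pow_succ] at hm'; linarith
  have hex : ∀ y ∈ S, ∃ z ∈ Z, dist y z ≤ ρ / 2 := by
    intro y hy
    have : y ∈ Metric.closedBall x (2 ^ m * (ρ / 2)) := (hSx y hy).trans hR'
    obtain ⟨z, hz, hyz⟩ := Set.mem_iUnion₂.1 (hcov this)
    exact ⟨z, hz, hyz⟩
  choose! g hg hgd using hex
  have hcard : S.card ≤ Z.card := by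
    refine Finset.card_le_card_of_injOn g (fun y hy => hg y hy) ?_
    intro y hy y' hy' hyy
    by_contra hne
    have h2 := hS y hy y' hy' hne
    have h3 := hgd y hy
    have h4 := hgd y' hy'
    rw [← hyy] at h4
    linarith [dist_triangle_right y y' (g y)]
  calc (S.card : ℝ) ≤ Z.card := by exact_mod_cast hcard
    _ ≤ ((2 : ℝ) ^ k) ^ m := hZ
    _ = ((2 : ℝ) ^ m) ^ k := by
        rw [← Real.rpow_natCast, ← Real.rpow_natCast, ← Real.rpow_mul (by norm_num),
          ← Real.rpow_mul (by norm_num), mul_comm]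
    _ ≤ (4 * R / ρ) ^ k := Real.rpow_le_rpow (by positivity) hm hk

end Packing

namespace NetTree

variable {X : Type u} [MetricSpace X] [Fintype X] {s : ℝ} {L : ℕ} (H : NetTree X s L)

/-! ### Nets and ancestors -/

lemma N_anti {i j : ℕ} (hij : i ≤ j) (hj : j ≤ L) : H.N j ⊆ H.N i := by
  induction j, hij using Nat.le_induction with
  | base => exact subset_rfl
  | succ j _ ih => exact (H.nested j hj).trans (ih (by omega))

lemma isPacking_N (hs : 4 ≤ s) (hX : ∀ x y : X, x ≠ y → 1 ≤ dist x y) {i : ℕ} (hi : i ≤ L) :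
    IsPacking (s ^ i / 2) (H.N i : Set X) := by
  intro x hx y hy hxy
  rcases Nat.eq_zero_or_pos i with rfl | h0
  · have := hX x y hxy
    norm_num
    linarith
  · have h1 := (H.net i h0 hi).2.1 x hx y hy hxy
    have : 0 < s ^ i := by positivity
    linarith

lemma exists_mem_N {i : ℕ} (hi : i ≤ L) (x : X) : ∃ u ∈ H.N i, dist x u ≤ s ^ i := by
  rcases Nat.eq_zero_or_pos i with rfl | h0
  · exact ⟨x, by simp [H.N_zero], by simp⟩
  · obtain ⟨u, hu, hux⟩ := (H.net i h0 hi).2.2 x (Set.mem_univ x)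
    exact ⟨u, hu, by rwa [dist_comm]⟩

lemma anc_mem {j : ℕ} (hj : j ≤ L) (x : X) : H.anc j x ∈ H.N j := by
  induction j with
  | zero => simp [H.N_zero]
  | succ j ih => exact H.par_mem j hj _ (ih (by omega))

lemma dist_anc_le (hs : 4 ≤ s) {j : ℕ} (hj : j ≤ L) (x : X) :
    dist x (H.anc j x) ≤ 4 / 3 * s ^ j := by
  induction j with
  | zero => norm_num [anc]
  | succ j ih =>
    have h1 := ih (by omega)
    have h2 : dist (H.anc j x) (H.anc (j + 1) x) ≤ s ^ (j + 1) := by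
      obtain ⟨v, hv, hd⟩ := H.exists_mem_N hj (H.anc j x)
      exact (H.par_closest j hj _ (H.anc_mem (by omega) x) v hv).trans hd
    have h3 : s ^ j * 4 ≤ s ^ (j + 1) := by
      rw [pow_succ]; gcongr
    linarith [dist_triangle x (H.anc j x) (H.anc (j + 1) x)]

include H in
lemma dist_le_top (x y : X) : dist x y ≤ 2 * s ^ L := by
  obtain ⟨u, hu, hx⟩ := H.exists_mem_N le_rfl x
  obtain ⟨v, hv, hy⟩ := H.exists_mem_N le_rfl y
  obtain ⟨w, hw⟩ := Finset.card_eq_one.1 H.top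
  rw [hw, Finset.mem_singleton] at hu hv
  rw [hu] at hx
  rw [hv] at hy
  linarith [dist_triangle_right x y w]

/-! ### Portal nodes -/

/-- The exponent `j` with `s ^ j ≤ θ * s ^ i < s ^ (j + 1)`. -/
noncomputable def portalLevel (s θ : ℝ) (i : ℕ) : ℤ := ⌊Real.logb s (θ * s ^ i)⌋

lemma portalLevel_spec (hs : 4 ≤ s) {θ : ℝ} (hθ : 0 < θ) (i : ℕ) :
    s ^ portalLevel s θ i ≤ θ * s ^ i ∧ θ * s ^ i < s ^ (portalLevel s θ i + 1) := by
  have hs1 : 1 < s := by linarith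
  have hpos : 0 < θ * s ^ i := by positivity
  rw [← Real.rpow_intCast, ← Real.rpow_intCast, ← Real.le_logb_iff_rpow_le hs1 hpos,
    ← Real.logb_lt_iff_lt_rpow hs1 hpos]
  refine ⟨Int.floor_le _, ?_⟩
  push_cast
  exact Int.lt_floor_add_one _

lemma eq_portalLevel (hs : 4 ≤ s) {θ : ℝ} (hθ : 0 < θ) {i : ℕ} {j : ℤ}
    (h1 : s ^ j ≤ θ * s ^ i) (h2 : θ * s ^ i < s ^ (j + 1)) : j = portalLevel s θ i := by
  have hs1 : 1 < s := by linarith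
  obtain ⟨h3, h4⟩ := portalLevel_spec hs hθ i
  have h5 := (zpow_lt_zpow_iff_right₀ hs1).1 (h1.trans_lt h4)
  have h6 := (zpow_lt_zpow_iff_right₀ hs1).1 (h3.trans_lt h2)
  omega

lemma portalLevel_le (hs : 4 ≤ s) {θ : ℝ} (hθ : 0 < θ) (hθ1 : θ ≤ 1) (i : ℕ) :
    (portalLevel s θ i).toNat ≤ i := by
  have hs1 : 1 < s := by linarith
  have h := (portalLevel_spec hs hθ i).1
  have h2 : s ^ portalLevel s θ i ≤ s ^ (i : ℤ) := by
    rw [zpow_natCast]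
    exact h.trans (mul_le_of_le_one_left (by positivity) hθ1)
  have := (zpow_le_zpow_iff_right₀ hs1).1 h2
  omega

/-- The portal node to which `x` is moved at height `i`. -/
noncomputable def portalNode (θ : ℝ) (i : ℕ) (x : X) : X × ℕ :=
  (H.anc (portalLevel s θ i).toNat x, (portalLevel s θ i).toNat)

lemma portalNodes_eq (hs : 4 ≤ s) {θ : ℝ} (hθ : 0 < θ) (i : ℕ) (C : Set X) :
    H.portalNodes θ i C = H.portalNode θ i '' C := by
  ext p
  constructor
  · rintro ⟨j, h1, h2, u, hu, rfl⟩
    obtain rfl := eq_portalLevel hs hθ h1 h2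
    exact ⟨u, hu, rfl⟩
  · rintro ⟨u, hu, rfl⟩
    exact ⟨_, (portalLevel_spec hs hθ i).1, (portalLevel_spec hs hθ i).2, u, hu, rfl⟩

lemma dist_portalNode (hs : 4 ≤ s) {θ : ℝ} (hθ : 0 < θ) (hθ1 : θ ≤ 1) {i : ℕ} (hi : i ≤ L)
    (x : X) : dist x (H.portalNode θ i x).1 ≤ 4 / 3 * (θ * s ^ i) := by
  have hle := portalLevel_le hs hθ hθ1 i
  have hspec := (portalLevel_spec hs hθ i).1
  have hd := H.dist_anc_le hs (hle.trans hi) x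
  rcases le_or_gt 0 (portalLevel s θ i) with h0 | h0
  · have : s ^ (portalLevel s θ i).toNat = s ^ portalLevel s θ i := by
      rw [← zpow_natCast, Int.toNat_of_nonneg h0]
    rw [this] at hd
    exact hd.trans (by gcongr)
  · have : (portalLevel s θ i).toNat = 0 := by omega
    simp only [portalNode, this, anc, dist_self]
    positivity

lemma portalNode_zero (hs : 4 ≤ s) {θ : ℝ} (hθ : 0 < θ) (hθ1 : θ ≤ 1) (x : X) :
    H.portalNode θ 0 x = (x, 0) := by
  have : (portalLevel s θ 0).toNat = 0 := by simpa using portalLevel_le hs hθ hθ1 0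
  simp [portalNode, this, anc]

/-! ### Clusters -/

lemma radius_eq (h : H.Idx → ℝ) {i : ℕ} (hi : i < L + 1) {u : X} (hu : u ∈ H.N i) :
    H.radius h i u = s ^ i + h ⟨⟨i, hi⟩, ⟨u, hu⟩⟩ := by
  rw [radius, dif_pos hi, dif_pos hu]

variable {H}

lemma Admissible.radius_mem {h : H.Idx → ℝ} (hs : 4 ≤ s) (hh : H.Admissible h) (i : ℕ) (u : X) :
    s ^ i ≤ H.radius h i u ∧ H.radius h i u ≤ 2 * s ^ i := by
  have : 0 < s ^ i := by positivity
  rw [radius]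
  split_ifs with h1 h2
  · have := hh ⟨⟨i, h1⟩, ⟨u, h2⟩⟩
    rw [Set.mem_Icc] at this
    constructor <;> linarith [this.1, this.2]
  · constructor <;> linarith
  · constructor <;> linarith

variable {ord : ℕ → X → ℕ} {h : H.Idx → ℝ}

lemma exists_isCenter_of_mem {i : ℕ} {x v : X} (hv : v ∈ H.N i)
    (hx : x ∈ Metric.closedBall v (H.radius h i v)) : ∃ u, H.IsCenter ord h i u x := by
  classical
  obtain ⟨u, hu, hmin⟩ := Finset.exists_min_image
    ((H.N i).filter fun v => x ∈ Metric.closedBall v (H.radius h i v)) (ord i)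
    ⟨v, Finset.mem_filter.2 ⟨hv, hx⟩⟩
  rw [Finset.mem_filter] at hu
  exact ⟨u, hu.1, hu.2, fun w hw hxw => hmin w (Finset.mem_filter.2 ⟨hw, hxw⟩)⟩

lemma Admissible.exists_isCenter (hs : 4 ≤ s) (hh : H.Admissible h) {i : ℕ} (hi : i ≤ L) (x : X) :
    ∃ u, H.IsCenter ord h i u x := by
  obtain ⟨u, hu, hd⟩ := H.exists_mem_N hi x
  exact exists_isCenter_of_mem hu (hd.trans (hh.radius_mem hs i u).1)

lemma IsCenter.unique (hord : ∀ i ≤ L, Set.InjOn (ord i) (H.N i : Set X)) {i : ℕ} (hi : i ≤ L)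
    {u v x : X} (hu : H.IsCenter ord h i u x) (hv : H.IsCenter ord h i v x) : u = v :=
  hord i hi hu.1 hv.1 (le_antisymm (hu.2.2 v hv.1 hv.2.1) (hv.2.2 u hu.1 hu.2.1))

lemma mem_clusterOf_self (hs : 4 ≤ s) (hh : H.Admissible h) (i : ℕ) (x : X) :
    x ∈ H.clusterOf ord h i x := by
  intro j _ hj
  obtain ⟨u, hu⟩ := hh.exists_isCenter (ord := ord) hs hj.le x
  exact ⟨u, hu, hu⟩

lemma clusterOf_symm {i : ℕ} {x y : X} (hxy : y ∈ H.clusterOf ord h i x) :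
    x ∈ H.clusterOf ord h i y := fun j hij hj =>
  let ⟨u, hu, hu'⟩ := hxy j hij hj
  ⟨u, hu', hu⟩

lemma clusterOf_subset_of_mem (hord : ∀ i ≤ L, Set.InjOn (ord i) (H.N i : Set X)) {i : ℕ}
    {x y : X} (hxy : y ∈ H.clusterOf ord h i x) :
    H.clusterOf ord h i y ⊆ H.clusterOf ord h i x := by
  intro z hz j hij hj
  obtain ⟨u, hu, hu'⟩ := hxy j hij hj
  obtain ⟨v, hv, hv'⟩ := hz j hij hj
  obtain rfl := hu'.unique hord hj.le hv
  exact ⟨u, hu, hv'⟩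

lemma clusterOf_eq_of_mem (hord : ∀ i ≤ L, Set.InjOn (ord i) (H.N i : Set X)) {i : ℕ} {x y : X}
    (hxy : y ∈ H.clusterOf ord h i x) : H.clusterOf ord h i y = H.clusterOf ord h i x :=
  (clusterOf_subset_of_mem hord hxy).antisymm
    (clusterOf_subset_of_mem hord (clusterOf_symm hxy))

lemma clusterOf_mono {i j : ℕ} (hij : i ≤ j) (x : X) :
    H.clusterOf ord h i x ⊆ H.clusterOf ord h j x :=
  fun _ hy j' hj' hL => hy j' (hij.trans hj') hL

lemma clusterOf_eq_univ {i : ℕ} (hi : L ≤ i) (x : X) : H.clusterOf ord h i x = Set.univ :=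
  Set.eq_univ_of_forall fun _ j hj hL => absurd hL (by omega)

lemma dist_le_of_mem_clusterOf (hs : 4 ≤ s) (hh : H.Admissible h) {i : ℕ} (hi : i < L) {x y : X}
    (hy : y ∈ H.clusterOf ord h i x) : dist y x ≤ 4 * s ^ i := by
  obtain ⟨u, hu, hu'⟩ := hy i le_rfl hi
  have h1 := (Metric.mem_closedBall.1 hu.2.1).trans (hh.radius_mem hs i u).2
  have h2 := (Metric.mem_closedBall.1 hu'.2.1).trans (hh.radius_mem hs i u).2
  linarith [dist_triangle_right y x u]

/-- The partition of height `i` puts `x` and `y` into different clusters. -/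
def Separated (H : NetTree X s L) (ord : ℕ → X → ℕ) (h : H.Idx → ℝ) (i : ℕ) (x y : X) : Prop :=
  ¬ ∃ u, H.IsCenter ord h i u x ∧ H.IsCenter ord h i u y

lemma Separated.symm {i : ℕ} {x y : X} (hxy : H.Separated ord h i x y) :
    H.Separated ord h i y x := fun ⟨u, hu, hu'⟩ => hxy ⟨u, hu', hu⟩

/-- Points that are in the same cluster of height `i + 1`, but not of height `i`, are separated
by the partition of height `i`. -/
lemma separated_of_ne (hs : 4 ≤ s) (hh : H.Admissible h)
    (hord : ∀ i ≤ L, Set.InjOn (ord i) (H.N i : Set X)) {i : ℕ} {x y : X}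
    (hne : H.clusterOf ord h i x ≠ H.clusterOf ord h i y)
    (heq : H.clusterOf ord h (i + 1) x = H.clusterOf ord h (i + 1) y) :
    H.Separated ord h i x y := by
  rintro ⟨u, hu, hu'⟩
  refine hne (clusterOf_eq_of_mem hord ?_)
  intro j hij hj
  rcases hij.eq_or_lt with rfl | hlt
  · exact ⟨u, hu', hu⟩
  · have : x ∈ H.clusterOf ord h (i + 1) y := by
      rw [← heq]; exact mem_clusterOf_self hs hh _ x
    exact this j hlt hj

/-- If `x` and `y` are separated by the partition of height `i`, then some ball of that height
contains exactly one of them, and no earlier ball contains `x` or `y`. -/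
lemma Separated.exists_cut (hs : 4 ≤ s) (hh : H.Admissible h) {i : ℕ} (hi : i ≤ L) {x y : X}
    (hxy : H.Separated ord h i x y) :
    ∃ u ∈ H.N i, ((x ∈ Metric.closedBall u (H.radius h i u) ∧
        y ∉ Metric.closedBall u (H.radius h i u)) ∨
      (y ∈ Metric.closedBall u (H.radius h i u) ∧
        x ∉ Metric.closedBall u (H.radius h i u))) ∧
      ∀ v ∈ H.N i, ord i v < ord i u → x ∉ Metric.closedBall v (H.radius h i v) ∧
        y ∉ Metric.closedBall v (H.radius h i v) := by
  obtain ⟨u, hu⟩ := hh.exists_isCenter (ord := ord) hs hi x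
  obtain ⟨v, hv⟩ := hh.exists_isCenter (ord := ord) hs hi y
  rcases le_total (ord i u) (ord i v) with huv | hvu
  · refine ⟨u, hu.1, Or.inl ⟨hu.2.1, fun hy => hxy ⟨u, hu, hu.1, hy, ?_⟩⟩, ?_⟩
    · exact fun w hw hyw => huv.trans (hv.2.2 w hw hyw)
    · exact fun w hw hlt => ⟨fun hx => absurd (hu.2.2 w hw hx) (by omega),
        fun hy => absurd (hv.2.2 w hw hy) (by omega)⟩
  · refine ⟨v, hv.1, Or.inr ⟨hv.2.1, fun hx => hxy ⟨v, ⟨hv.1, hx, ?_⟩, hv⟩⟩, ?_⟩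
    · exact fun w hw hxw => hvu.trans (hu.2.2 w hw hxw)
    · exact fun w hw hlt => ⟨fun hx => absurd (hu.2.2 w hw hx) (by omega),
        fun hy => absurd (hv.2.2 w hw hy) (by omega)⟩

end NetTree

/-! ### Weights -/

section Weight

variable {X : Type u} [MetricSpace X]

@[simp] lemma edgeLen_mk (x y : X) : edgeLen s(x, y) = dist x y := rfl

lemma edgeLen_nonneg (e : Sym2 X) : 0 ≤ edgeLen e := by
  induction e with
  | _ x y => exact dist_nonneg

@[simp] lemma weight_zero : weight (0 : MGraph X) = 0 := by simp [weight]

@[simp] lemma weight_cons (e : Sym2 X) (F : MGraph X) :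
    weight (e ::ₘ F) = edgeLen e + weight F := by simp [weight]

lemma weight_nonneg (F : MGraph X) : 0 ≤ weight F :=
  Multiset.sum_nonneg fun _ hx => by
    obtain ⟨e, -, rfl⟩ := Multiset.mem_map.1 hx
    exact edgeLen_nonneg e

@[simp] lemma portalWeight_zero : portalWeight (0 : MGraph (Portal X)) = 0 := by
  simp [portalWeight]

@[simp] lemma portalWeight_cons (p p' : Portal X) (F : MGraph (Portal X)) :
    portalWeight (s(p, p') ::ₘ F) = dist p.node.1 p'.node.1 + portalWeight F := by
  simp [portalWeight]

@[simp] lemma portalWeight_add (F G : MGraph (Portal X)) :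
    portalWeight (F + G) = portalWeight F + portalWeight G := by
  simp [portalWeight, weight]

@[simp] lemma portalWeight_singleton (p p' : Portal X) :
    portalWeight {s(p, p')} = dist p.node.1 p'.node.1 := by
  simp [portalWeight, weight]

lemma portalWeight_bind_le {R : Sym2 X → MGraph (Portal X)} {c : Sym2 X → ℝ}
    (hR : ∀ e, portalWeight (R e) ≤ c e) (F : MGraph X) :
    portalWeight (F.bind R) ≤ (F.map c).sum := by
  induction F using Multiset.induction with
  | empty => simp
  | cons e F ih =>
    rw [Multiset.cons_bind, portalWeight_add, Multiset.map_cons, Multiset.sum_cons]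
    exact add_le_add (hR e) ih

end Weight

/-! ### Rerouting an edge through portals -/

section Hub

variable {X : Type u}

open Classical in
/-- A chosen point of the set `C` (the default value `x` is used only if `C` is empty). -/
noncomputable def hub (C : Set X) (x : X) : X := if hC : C.Nonempty then hC.some else x

lemma hub_mem {C : Set X} {y : X} (hy : y ∈ C) (x : X) : hub C x ∈ C := by
  have hC : C.Nonempty := ⟨y, hy⟩
  rw [hub, dif_pos hC]
  exact hC.some_mem

lemma hub_eq {C : Set X} {y : X} (hy : y ∈ C) (x x' : X) : hub C x = hub C x' := by
  have hC : C.Nonempty := ⟨y, hy⟩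
  rw [hub, hub, dif_pos hC, dif_pos hC]

variable (cl : ℕ → X → Set X)

/-- The smallest height at which `x` and `y` lie in the same cluster, where `cl i x` is the cluster
of `x` at height `i`. -/
noncomputable def mergeHeight (x y : X) : ℕ := sInf {i | cl i x = cl i y}

lemma mergeHeight_comm (x y : X) : mergeHeight cl x y = mergeHeight cl y x := by
  simp only [mergeHeight, eq_comm]

/-- The portal `(x, 0)` of the height-`0` cluster of `x`. -/
def basePortal (x : X) : Portal X := ⟨0, cl 0 x, (x, 0)⟩

end Hub

namespace NetTree

variable {X : Type u} [MetricSpace X] [Fintype X] {s : ℝ} {L : ℕ} (H : NetTree X s L)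

variable (θ : ℝ) (cl : ℕ → X → Set X) (t : ℕ)

/-- The portal of the height-`i` cluster of `x` used by an edge at `x` whose endpoints first lie
in a common cluster at height `κ`. At the `t` topmost heights below `κ` it is the portal next to
`x`; further down, it is the portal next to the hub of the cluster, which does not depend on the
edge. -/
noncomputable def routeVertex (κ i : ℕ) (x : X) : Portal X :=
  ⟨i, cl i x, H.portalNode θ i (if κ ≤ i + t then x else hub (cl i x) x)⟩

/-- The path from the base portal of `x` up to the route vertex at height `m`. -/
noncomputable def climb (κ : ℕ) (x : X) : ℕ → MGraph (Portal X)
  | 0 => {s(basePortal cl x, H.routeVertex θ cl t κ 0 x)}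
  | m + 1 => s(H.routeVertex θ cl t κ m x, H.routeVertex θ cl t κ (m + 1) x) ::ₘ climb κ x m

/-- The path from `x` to `y` that climbs on both sides to height `κ - 1`, where it crosses over; for
`κ = 0` it is a single edge. -/
noncomputable def routeVia (x y : X) : ℕ → MGraph (Portal X)
  | 0 => {s(basePortal cl x, basePortal cl y)}
  | m + 1 => s(H.routeVertex θ cl t (m + 1) m x, H.routeVertex θ cl t (m + 1) m y) ::ₘ
      (H.climb θ cl t (m + 1) x m + H.climb θ cl t (m + 1) y m)

lemma routeVia_comm (x y : X) (κ : ℕ) : H.routeVia θ cl t x y κ = H.routeVia θ cl t y x κ := by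
  cases κ with
  | zero => rw [routeVia, routeVia, Sym2.eq_swap]
  | succ m => rw [routeVia, routeVia, Sym2.eq_swap, add_comm (H.climb θ cl t (m + 1) x m)]

/-- The path through portals that replaces an edge. -/
noncomputable def route : Sym2 X → MGraph (Portal X) :=
  Sym2.lift ⟨fun x y => H.routeVia θ cl t x y (mergeHeight cl x y), fun x y => by
    simp only [mergeHeight_comm cl x y, routeVia_comm H θ cl t x y]⟩

lemma route_mk (x y : X) :
    H.route θ cl t s(x, y) = H.routeVia θ cl t x y (mergeHeight cl x y) := rfl

/-- The multigraph on portals obtained by rerouting all edges. -/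
noncomputable def reroute (T : MGraph X) : MGraph (Portal X) := T.bind (H.route θ cl t)

lemma climb_trail (κ : ℕ) (x : X) (m : ℕ) :
    Trail (basePortal cl x) (H.routeVertex θ cl t κ m x) (H.climb θ cl t κ x m) := by
  induction m with
  | zero => exact Trail.single _ _
  | succ m ih =>
    rw [climb, ← Multiset.singleton_add, add_comm (_ : MGraph (Portal X))]
    exact ih.trans (Trail.single _ _)

lemma route_trail (x y : X) :
    Trail (basePortal cl x) (basePortal cl y) (H.route θ cl t s(x, y)) := by
  rw [route_mk]
  cases mergeHeight cl x y with
  | zero => exact Trail.single _ _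
  | succ m =>
    have h := ((H.climb_trail θ cl t (m + 1) x m).trans (Trail.single _ _)).trans
      (H.climb_trail θ cl t (m + 1) y m).symm
    rwa [add_comm (H.climb θ cl t (m + 1) x m), Multiset.singleton_add, Multiset.cons_add] at h

lemma route_ne_zero (e : Sym2 X) : H.route θ cl t e ≠ 0 := by
  induction e with
  | _ x y =>
    rw [route_mk]
    cases mergeHeight cl x y with
    | zero => simp [routeVia]
    | succ m => simp [routeVia]

variable {θ cl t}

lemma visits_reroute {T : MGraph X} {x : X} (hx : x ∈ verts T) :
    Visits (H.reroute θ cl t T) x := by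
  obtain ⟨e, he, hxe⟩ := hx
  obtain ⟨y, rfl⟩ := Sym2.mem_iff_exists.1 hxe
  -- the base portal of `x` lies on the route
  have hmem : basePortal cl x ∈ verts (H.route θ cl t s(x, y)) := by
    rw [route_mk]
    cases mergeHeight cl x y with
    | zero => exact ⟨_, Multiset.mem_singleton_self _, Sym2.mem_mk_left _ _⟩
    | succ m =>
      have h : ∀ m κ, basePortal cl x ∈ verts (H.climb θ cl t κ x m) := by
        intro m κ
        induction m with
        | zero => exact ⟨_, Multiset.mem_singleton_self _, Sym2.mem_mk_left _ _⟩
        | succ m ih =>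
          obtain ⟨e, he, hxe⟩ := ih
          exact ⟨e, Multiset.mem_cons_of_mem he, hxe⟩
      obtain ⟨e, he, hxe⟩ := h m (m + 1)
      exact ⟨e, Multiset.mem_cons_of_mem (Multiset.mem_add.2 (Or.inl he)), hxe⟩
  obtain ⟨e', he', hxe'⟩ := hmem
  exact ⟨_, ⟨e', Multiset.mem_bind.2 ⟨_, he, he'⟩, hxe'⟩, rfl⟩

lemma mem_climb {κ m : ℕ} {x : X} {e : Sym2 (Portal X)} (he : e ∈ H.climb θ cl t κ x m) :
    e = s(basePortal cl x, H.routeVertex θ cl t κ 0 x) ∨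
    ∃ i < m, e = s(H.routeVertex θ cl t κ i x, H.routeVertex θ cl t κ (i + 1) x) := by
  induction m with
  | zero => exact Or.inl (Multiset.mem_singleton.1 he)
  | succ m ih =>
    rcases Multiset.mem_cons.1 he with rfl | he
    · exact Or.inr ⟨m, by omega, rfl⟩
    · rcases ih he with h | ⟨i, hi, h⟩
      · exact Or.inl h
      · exact Or.inr ⟨i, by omega, h⟩

/-- The edges of a rerouted multigraph. -/
lemma mem_reroute {T : MGraph X} {e : Sym2 (Portal X)} (he : e ∈ H.reroute θ cl t T) :
    ∃ x y, s(x, y) ∈ T ∧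
      ((mergeHeight cl x y = 0 ∧ e = s(basePortal cl x, basePortal cl y)) ∨
      (0 < mergeHeight cl x y ∧
        e = s(basePortal cl x, H.routeVertex θ cl t (mergeHeight cl x y) 0 x)) ∨
      (∃ i, i + 1 < mergeHeight cl x y ∧
        e = s(H.routeVertex θ cl t (mergeHeight cl x y) i x,
          H.routeVertex θ cl t (mergeHeight cl x y) (i + 1) x)) ∨
      ∃ m, mergeHeight cl x y = m + 1 ∧
        e = s(H.routeVertex θ cl t (mergeHeight cl x y) m x,
          H.routeVertex θ cl t (mergeHeight cl x y) m y)) := by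
  obtain ⟨e', he', hee⟩ := Multiset.mem_bind.1 he
  induction e' with
  | _ x y =>
    rw [route_mk] at hee
    rcases hκ : mergeHeight cl x y with _ | m
    · rw [hκ] at hee
      exact ⟨x, y, he', Or.inl ⟨hκ, Multiset.mem_singleton.1 hee⟩⟩
    · rw [hκ] at hee
      rcases Multiset.mem_cons.1 hee with rfl | hee
      · exact ⟨x, y, he', Or.inr (Or.inr (Or.inr ⟨m, hκ, by rw [hκ]⟩))⟩
      · have hκ' : mergeHeight cl y x = m + 1 := by rw [mergeHeight_comm, hκ]
        rcases Multiset.mem_add.1 hee with hee | hee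
        · refine ⟨x, y, he', ?_⟩
          rw [hκ]
          rcases H.mem_climb hee with rfl | ⟨i, hi, rfl⟩
          · exact Or.inr (Or.inl ⟨by omega, rfl⟩)
          · exact Or.inr (Or.inr (Or.inl ⟨i, by omega, rfl⟩))
        · refine ⟨y, x, by rwa [Sym2.eq_swap], ?_⟩
          rw [hκ']
          rcases H.mem_climb hee with rfl | ⟨i, hi, rfl⟩
          · exact Or.inr (Or.inl ⟨by omega, rfl⟩)
          · exact Or.inr (Or.inr (Or.inl ⟨i, by omega, rfl⟩))

/-! ### Routes in the hierarchical decomposition -/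

variable {H} {ord : ℕ → X → ℕ} {h : H.Idx → ℝ}

lemma mergeHeight_le (x y : X) : mergeHeight (H.clusterOf ord h) x y ≤ L :=
  Nat.sInf_le (by simp [clusterOf_eq_univ])

lemma cluster_mergeHeight (x y : X) :
    H.clusterOf ord h (mergeHeight (H.clusterOf ord h) x y) x =
      H.clusterOf ord h (mergeHeight (H.clusterOf ord h) x y) y :=
  Nat.sInf_mem (s := {i | H.clusterOf ord h i x = H.clusterOf ord h i y})
    ⟨L, by simp [clusterOf_eq_univ]⟩

lemma cluster_ne_of_lt_mergeHeight {i : ℕ} {x y : X}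
    (hi : i < mergeHeight (H.clusterOf ord h) x y) :
    H.clusterOf ord h i x ≠ H.clusterOf ord h i y :=
  Nat.notMem_of_lt_sInf hi

lemma SameParent.symm {i : ℕ} {C C' : Set X} (hC : H.SameParent ord h i C C') :
    H.SameParent ord h i C' C :=
  let ⟨x, h1, h2⟩ := hC
  ⟨x, h2, h1⟩

lemma isPortal_routeVertex (hs : 4 ≤ s) (hh : H.Admissible h) (hθ : 0 < θ) {κ i : ℕ}
    (hi : i < L) (x : X) : H.IsPortal θ ord h (H.routeVertex θ (H.clusterOf ord h) t κ i x) := by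
  refine ⟨⟨hi, x, rfl⟩, ?_⟩
  rw [portalNodes_eq H hs hθ]
  refine ⟨_, ?_, rfl⟩
  have hx := mem_clusterOf_self (ord := ord) hs hh i x
  split_ifs
  · exact hx
  · exact hub_mem hx x

lemma isPortal_basePortal (hs : 4 ≤ s) (hh : H.Admissible h) (hθ : 0 < θ) (hθ1 : θ ≤ 1)
    (hL : 1 ≤ L) (x : X) : H.IsPortal θ ord h (basePortal (H.clusterOf ord h) x) := by
  refine ⟨⟨hL, x, rfl⟩, ?_⟩
  rw [portalNodes_eq H hs hθ]
  exact ⟨x, mem_clusterOf_self hs hh 0 x, H.portalNode_zero hs hθ hθ1 x⟩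

lemma portalRespecting_reroute (hs : 4 ≤ s) (hh : H.Admissible h) (hθ : 0 < θ) (hθ1 : θ ≤ 1)
    (hL : 1 ≤ L) (T : MGraph X) :
    H.PortalRespecting θ ord h (H.reroute θ (H.clusterOf ord h) t T) := by
  have key : ∀ e ∈ H.reroute θ (H.clusterOf ord h) t T, ∃ a b : Portal X, e = s(a, b) ∧
      H.IsPortal θ ord h a ∧ H.IsPortal θ ord h b ∧
      ((a.height = b.height ∧ H.SameParent ord h a.height a.cluster b.cluster) ∨
        (b.height = a.height + 1 ∧ a.cluster ⊆ b.cluster)) := by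
    intro e he
    obtain ⟨x, y, -, h1 | h1 | h1 | h1⟩ := H.mem_reroute he
    · obtain ⟨hκ, rfl⟩ := h1
      have heq := cluster_mergeHeight (H := H) (ord := ord) (h := h) x y
      rw [hκ] at heq
      exact ⟨_, _, rfl, isPortal_basePortal hs hh hθ hθ1 hL x,
        isPortal_basePortal hs hh hθ hθ1 hL y, Or.inl ⟨rfl, x,
          clusterOf_mono (Nat.le_succ _) x, heq.symm.subset.trans
            (clusterOf_mono (Nat.le_succ _) x)⟩⟩
    · obtain ⟨-, rfl⟩ := h1
      exact ⟨_, _, rfl, isPortal_basePortal hs hh hθ hθ1 hL x,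
        isPortal_routeVertex hs hh hθ hL x, Or.inl ⟨rfl, x,
          clusterOf_mono (Nat.le_succ _) x, clusterOf_mono (Nat.le_succ _) x⟩⟩
    · obtain ⟨i, hi, rfl⟩ := h1
      have hκ := mergeHeight_le (H := H) (ord := ord) (h := h) x y
      exact ⟨_, _, rfl, isPortal_routeVertex hs hh hθ (by omega) x,
        isPortal_routeVertex hs hh hθ (by omega) x, Or.inr ⟨rfl,
          clusterOf_mono (Nat.le_succ _) x⟩⟩
    · obtain ⟨m, hm, rfl⟩ := h1
      have hκ := mergeHeight_le (H := H) (ord := ord) (h := h) x y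
      have heq := cluster_mergeHeight (H := H) (ord := ord) (h := h) x y
      rw [hm] at heq
      exact ⟨_, _, rfl, isPortal_routeVertex hs hh hθ (by omega) x,
        isPortal_routeVertex hs hh hθ (by omega) y, Or.inl ⟨rfl, x,
          clusterOf_mono (Nat.le_succ _) x,
          (clusterOf_mono (Nat.le_succ _) y).trans heq.symm.subset⟩⟩
  constructor
  · rintro p ⟨e, he, hp⟩
    obtain ⟨a, b, rfl, ha, hb, -⟩ := key e he
    rcases Sym2.mem_iff.1 hp with rfl | rfl
    · exact ha
    · exact hb
  · intro p p' hpp hle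
    obtain ⟨a, b, hab, -, -, hor⟩ := key _ hpp
    rcases Sym2.eq_iff.1 hab with ⟨rfl, rfl⟩ | ⟨rfl, rfl⟩
    · rcases hor with hor | hor
      · exact Or.inl hor
      · omega
    · rcases hor with hor | hor
      · exact Or.inl ⟨hor.1.symm, by rw [← hor.1]; exact hor.2.symm⟩
      · exact Or.inr hor

/-- Active portals are route vertices. -/
lemma IsActive.exists_routeVertex {T : MGraph X} {p : Portal X}
    (hp : H.IsActive ord h (H.reroute θ (H.clusterOf ord h) t T) p) :
    ∃ x y, s(x, y) ∈ T ∧ p.height < mergeHeight (H.clusterOf ord h) x y ∧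
      p = H.routeVertex θ (H.clusterOf ord h) t (mergeHeight (H.clusterOf ord h) x y)
        p.height x := by
  obtain ⟨p', hpp, hact⟩ := hp
  obtain ⟨x, y, hT, h1 | h1 | h1 | h1⟩ := H.mem_reroute hpp
  · -- an edge within a cluster of height `0`
    exfalso
    obtain ⟨hκ, he⟩ := h1
    have heq := cluster_mergeHeight (H := H) (ord := ord) (h := h) x y
    rw [hκ] at heq
    rcases Sym2.eq_iff.1 he with ⟨rfl, rfl⟩ | ⟨rfl, rfl⟩ <;>
      simp [basePortal, heq] at hact
  · exfalso
    obtain ⟨hκ, he⟩ := h1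
    rcases Sym2.eq_iff.1 he with ⟨rfl, rfl⟩ | ⟨rfl, rfl⟩ <;>
      simp [basePortal, routeVertex] at hact
  · obtain ⟨i, hi, he⟩ := h1
    rcases Sym2.eq_iff.1 he with ⟨rfl, rfl⟩ | ⟨rfl, rfl⟩
    · exact ⟨x, y, hT, by simp only [routeVertex]; omega, rfl⟩
    · exact ⟨x, y, hT, by simp only [routeVertex]; omega, rfl⟩
  · obtain ⟨m, hm, he⟩ := h1
    rcases Sym2.eq_iff.1 he with ⟨rfl, rfl⟩ | ⟨rfl, rfl⟩
    · exact ⟨x, y, hT, by simp only [routeVertex]; omega, rfl⟩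
    · refine ⟨y, x, by rwa [Sym2.eq_swap], ?_, ?_⟩
      · change m < mergeHeight _ y x
        rw [mergeHeight_comm]
        omega
      · rw [mergeHeight_comm _ y x]; rfl

/-! ### The length of a route -/

lemma sum_pow_le (hs : 4 ≤ s) (m : ℕ) : ∑ i ∈ Finset.range (m + 1), s ^ i ≤ 4 / 3 * s ^ m := by
  induction m with
  | zero => norm_num
  | succ m ih =>
    rw [Finset.sum_range_succ]
    have : s ^ m * 4 ≤ s ^ (m + 1) := by rw [pow_succ]; gcongr
    linarith

lemma sum_pow_shift_le (hs : 4 ≤ s) (t m : ℕ) :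
    ∑ i ∈ Finset.range (m + 1), (if m + 1 ≤ i + t then 0 else s ^ (i + t)) ≤ 4 / 3 * s ^ m := by
  refine le_trans ?_ (sum_pow_le hs m)
  have h1 : ∑ i ∈ Finset.range (m + 1), (if m + 1 ≤ i + t then 0 else s ^ (i + t)) =
      ∑ i ∈ (Finset.range (m + 1)).filter (fun i => i + t < m + 1), s ^ (i + t) := by
    rw [Finset.sum_filter]
    refine Finset.sum_congr rfl fun i _ => ?_
    by_cases hi : m + 1 ≤ i + t
    · rw [if_pos hi, if_neg (by omega)]
    · rw [if_neg hi, if_pos (by omega)]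
  rw [h1, ← Finset.sum_image (f := fun j => s ^ j) (g := fun i => i + t)
    (fun _ _ _ _ hab => by simpa using hab)]
  refine Finset.sum_le_sum_of_subset_of_nonneg ?_ fun _ _ _ => by positivity
  intro j hj
  obtain ⟨i, hi, rfl⟩ := Finset.mem_image.1 hj
  rw [Finset.mem_filter] at hi
  exact Finset.mem_range.2 hi.2

lemma dist_routeVertex (hs : 4 ≤ s) (hh : H.Admissible h) (hθ : 0 < θ) (hθ1 : θ ≤ 1)
    (ht : 1 ≤ θ * s ^ t) {κ i : ℕ} (hi : i < L) (x : X) :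
    dist x (H.routeVertex θ (H.clusterOf ord h) t κ i x).node.1 ≤
      4 / 3 * (θ * s ^ i) + 4 * (θ * if κ ≤ i + t then 0 else s ^ (i + t)) := by
  rw [routeVertex]
  split_ifs with hκ
  · simpa using H.dist_portalNode hs hθ hθ1 hi.le x
  · have hx := mem_clusterOf_self (ord := ord) hs hh i x
    have h1 := dist_le_of_mem_clusterOf hs hh hi (hub_mem hx x)
    have h2 := H.dist_portalNode hs hθ hθ1 hi.le (hub (H.clusterOf ord h i x) x)
    -- the hub is within `4 s ^ i`, which is at most `4 θ s ^ (i + t)` by the choice of `t`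
    have h3 : s ^ i ≤ θ * s ^ (i + t) := by
      calc s ^ i = s ^ i * 1 := (mul_one _).symm
        _ ≤ s ^ i * (θ * s ^ t) := by gcongr
        _ = θ * s ^ (i + t) := by ring
    rw [dist_comm] at h1
    have h4 := dist_triangle x (hub (H.clusterOf ord h i x) x)
      (H.portalNode θ i (hub (H.clusterOf ord h i x) x)).1
    linarith

lemma portalWeight_climb_le (κ : ℕ) (x : X) (m : ℕ) :
    portalWeight (H.climb θ cl t κ x m) + dist x (H.routeVertex θ cl t κ m x).node.1 ≤
      2 * ∑ i ∈ Finset.range (m + 1), dist x (H.routeVertex θ cl t κ i x).node.1 := by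
  induction m with
  | zero => simp [climb, basePortal, two_mul]
  | succ m ih =>
    rw [climb, portalWeight_cons, Finset.sum_range_succ]
    linarith [dist_triangle_left (H.routeVertex θ cl t κ m x).node.1
      (H.routeVertex θ cl t κ (m + 1) x).node.1 x]

open Classical in
/-- The sum of `s ^ i` over the heights `i < L` whose partition separates the ends of an edge. -/
noncomputable def sepCost (H : NetTree X s L) (ord : ℕ → X → ℕ) (h : H.Idx → ℝ) : Sym2 X → ℝ :=
  Sym2.lift ⟨fun x y => ∑ i ∈ Finset.range L, if H.Separated ord h i x y then s ^ i else 0,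
    fun x y => by
      have : ∀ i, H.Separated ord h i x y ↔ H.Separated ord h i y x :=
        fun i => ⟨Separated.symm, Separated.symm⟩
      simp only [this]⟩

/-- The detour of a route is proportional to `θ s ^ i`, where `i` is the largest height at which
the ends of the edge are separated. -/
lemma portalWeight_route_le (hs : 4 ≤ s) (hh : H.Admissible h)
    (hord : ∀ i ≤ L, Set.InjOn (ord i) (H.N i : Set X)) (hθ : 0 < θ) (hθ1 : θ ≤ 1)
    (ht : 1 ≤ θ * s ^ t) (e : Sym2 X) :
    portalWeight (H.route θ (H.clusterOf ord h) t e) ≤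
      edgeLen e + 40 * θ * H.sepCost ord h e := by
  classical
  induction e with
  | _ x y =>
    rw [route_mk, edgeLen_mk]
    have hs0 : (0 : ℝ) < s := by linarith
    have hcost : H.sepCost ord h s(x, y) =
      ∑ i ∈ Finset.range L, if H.Separated ord h i x y then s ^ i else 0 := rfl
    have hnn : ∀ i ∈ Finset.range L, (0 : ℝ) ≤ if H.Separated ord h i x y then s ^ i else 0 := by
      intro i _
      split_ifs <;> positivity
    rcases hκ : mergeHeight (H.clusterOf ord h) x y with _ | m
    · simp only [routeVia, portalWeight_singleton, basePortal]
      have : 0 ≤ H.sepCost ord h s(x, y) := by rw [hcost]; exact Finset.sum_nonneg hnn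
      have : 0 ≤ 40 * θ * H.sepCost ord h s(x, y) := by positivity
      linarith
    · have hmL : m < L := by have := mergeHeight_le (H := H) (ord := ord) (h := h) x y; omega
      have hsep : H.Separated ord h m x y := by
        refine separated_of_ne hs hh hord (cluster_ne_of_lt_mergeHeight (by omega)) ?_
        rw [← hκ]
        exact cluster_mergeHeight x y
      have hm : s ^ m ≤ H.sepCost ord h s(x, y) := by
        rw [hcost]
        have := Finset.single_le_sum hnn (Finset.mem_range.2 hmL)
        rwa [if_pos hsep] at this
      have hside : ∀ z, ∑ i ∈ Finset.range (m + 1),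
          dist z (H.routeVertex θ (H.clusterOf ord h) t (m + 1) i z).node.1 ≤
            10 * (θ * s ^ m) := by
        intro z
        calc _ ≤ ∑ i ∈ Finset.range (m + 1), (4 / 3 * (θ * s ^ i) +
              4 * (θ * if m + 1 ≤ i + t then 0 else s ^ (i + t))) := by
              refine Finset.sum_le_sum fun i hi => dist_routeVertex hs hh hθ hθ1 ht ?_ z
              have := Finset.mem_range.1 hi
              omega
          _ = 4 / 3 * (θ * ∑ i ∈ Finset.range (m + 1), s ^ i) +
              4 * (θ * ∑ i ∈ Finset.range (m + 1),
                if m + 1 ≤ i + t then 0 else s ^ (i + t)) := by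
              simp only [Finset.sum_add_distrib, Finset.mul_sum]
          _ ≤ 4 / 3 * (θ * (4 / 3 * s ^ m)) + 4 * (θ * (4 / 3 * s ^ m)) := by
              gcongr
              · exact sum_pow_le hs m
              · exact sum_pow_shift_le hs t m
          _ ≤ 10 * (θ * s ^ m) := by
              have : 0 < θ * s ^ m := by positivity
              linarith
      have h1 := portalWeight_climb_le (H := H) (θ := θ) (cl := H.clusterOf ord h) (t := t)
        (m + 1) x m
      have h2 := portalWeight_climb_le (H := H) (θ := θ) (cl := H.clusterOf ord h) (t := t)
        (m + 1) y m
      have h3 := hside x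
      have h4 := hside y
      have h5 := dist_triangle4_left x y
        (H.routeVertex θ (H.clusterOf ord h) t (m + 1) m x).node.1
        (H.routeVertex θ (H.clusterOf ord h) t (m + 1) m y).node.1
      have h6 : θ * s ^ m ≤ θ * H.sepCost ord h s(x, y) := by gcongr
      simp only [routeVia, portalWeight_cons, portalWeight_add]
      linarith

lemma portalWeight_reroute_le (hs : 4 ≤ s) (hh : H.Admissible h)
    (hord : ∀ i ≤ L, Set.InjOn (ord i) (H.N i : Set X)) (hθ : 0 < θ) (hθ1 : θ ≤ 1)
    (ht : 1 ≤ θ * s ^ t) (T : MGraph X) :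
    portalWeight (H.reroute θ (H.clusterOf ord h) t T) ≤
      weight T + 40 * θ * (T.map (H.sepCost ord h)).sum := by
  refine (portalWeight_bind_le (portalWeight_route_le hs hh hord hθ hθ1 ht) T).trans_eq ?_
  rw [Multiset.sum_map_add, Multiset.sum_map_mul_left, weight]

end NetTree

namespace NetTree

variable {X : Type u} [MetricSpace X] [Fintype X] {s : ℝ} {L : ℕ} {H : NetTree X s L}
  {θ k : ℝ} {t : ℕ} {ord : ℕ → X → ℕ} {h : H.Idx → ℝ}

/-! ### Counting portals -/

lemma card_near_le (hs : 4 ≤ s) (hX : ∀ x y : X, x ≠ y → 1 ≤ dist x y) (hD : DoublingDimLE X k)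
    (hk : 0 ≤ k) {j : ℕ} (hj : j ≤ L) {R : ℝ} (hR : s ^ j ≤ 8 * R) {S : Finset X}
    (hS : S ⊆ H.N j) {x : X} (hSx : ∀ y ∈ S, dist y x ≤ R) :
    (S.card : ℝ) ≤ (8 * R / s ^ j) ^ k := by
  have hpos : 0 < s ^ j := by positivity
  have hpack : IsPacking (s ^ j / 2) (S : Set X) := fun y hy z hz hyz =>
    H.isPacking_N hs hX hj y (hS hy) z (hS hz) hyz
  refine (hD.card_le hk (by positivity) (by linarith) hpack hSx).trans_eq ?_
  congr 1
  field_simp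
  ring

/-- Points of a ball of radius `R` that lie in the net at the height `j` with
`s ^ j ≤ θ s ^ i < s ^ (j + 1)`. -/
lemma card_near_portalLevel_le (hs : 4 ≤ s) (hX : ∀ x y : X, x ≠ y → 1 ≤ dist x y)
    (hD : DoublingDimLE X k) (hk : 0 ≤ k) (hθ : 0 < θ) (hθ1 : θ ≤ 1) {i : ℕ} (hi : i ≤ L)
    {S : Finset X} (hS : S ⊆ H.N (portalLevel s θ i).toNat) {x : X}
    (hSx : ∀ y ∈ S, dist y x ≤ 6 * s ^ i) : (S.card : ℝ) ≤ (48 * (s / θ)) ^ k := by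
  have hle := portalLevel_le hs hθ hθ1 i
  have hs1 : 1 ≤ s := by linarith
  have hpow : s ^ (portalLevel s θ i).toNat ≤ s ^ i := pow_le_pow_right₀ hs1 hle
  have hpos : 0 < s ^ i := by positivity
  refine (card_near_le hs hX hD hk (hle.trans hi) (R := 6 * s ^ i) (by linarith) hS hSx).trans ?_
  refine Real.rpow_le_rpow (by positivity) ?_ hk
  have h1 : θ * s ^ i ≤ s * s ^ (portalLevel s θ i).toNat := by
    have h2 := (portalLevel_spec hs hθ i).2.le
    rw [zpow_add₀ (by linarith), zpow_one] at h2
    have h3 : s ^ portalLevel s θ i ≤ s ^ (portalLevel s θ i).toNat := by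
      rw [← zpow_natCast]
      exact zpow_le_zpow_right₀ hs1 (Int.self_le_toNat _)
    nlinarith
  have hp2 : 0 < s ^ (portalLevel s θ i).toNat := by positivity
  rw [div_le_iff₀ hp2]
  calc 8 * (6 * s ^ i) = 48 / θ * (θ * s ^ i) := by field_simp; ring
    _ ≤ 48 / θ * (s * s ^ (portalLevel s θ i).toNat) := by gcongr
    _ = 48 * (s / θ) * s ^ (portalLevel s θ i).toNat := by ring

lemma portalNodes_finite (hs : 4 ≤ s) (hθ : 0 < θ) (i : ℕ) (C : Set X) :
    (H.portalNodes θ i C).Finite := by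
  rw [portalNodes_eq H hs hθ]
  exact C.toFinite.image _

lemma portalNodes_ncard_le (hs : 4 ≤ s) (hX : ∀ x y : X, x ≠ y → 1 ≤ dist x y)
    (hD : DoublingDimLE X k) (hk : 0 ≤ k) (hh : H.Admissible h) (hθ : 0 < θ) (hθ1 : θ ≤ 1)
    {i : ℕ} (hi : i < L) (x : X) :
    ((H.portalNodes θ i (H.clusterOf ord h i x)).ncard : ℝ) ≤ (48 * (s / θ)) ^ k := by
  classical
  set j := (portalLevel s θ i).toNat
  set S : Finset X := (H.clusterOf ord h i x).toFinset.image (fun y => H.anc j y) with hS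
  have hsub : H.portalNodes θ i (H.clusterOf ord h i x) ⊆ (S.image fun y => (y, j) : Finset _) := by
    rw [portalNodes_eq H hs hθ]
    rintro - ⟨y, hy, rfl⟩
    simp only [hS, Finset.coe_image, Set.mem_image, Finset.mem_coe]
    exact ⟨H.anc j y, ⟨y, by simpa using hy, rfl⟩, rfl⟩
  have h1 : (H.portalNodes θ i (H.clusterOf ord h i x)).ncard ≤ S.card :=
    (Set.ncard_le_ncard hsub (Finset.finite_toSet _)).trans
      ((Set.ncard_coe_finset _).trans_le Finset.card_image_le)
  refine le_trans (by exact_mod_cast h1)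
    (card_near_portalLevel_le (H := H) hs hX hD hk hθ hθ1 hi.le (S := S) (x := x) ?_ ?_)
  · intro z hz
    obtain ⟨y, -, rfl⟩ := Finset.mem_image.1 hz
    exact H.anc_mem ((portalLevel_le hs hθ hθ1 i).trans hi.le) y
  · intro z hz
    obtain ⟨y, hy, rfl⟩ := Finset.mem_image.1 hz
    have hd1 := dist_le_of_mem_clusterOf hs hh hi (by simpa using hy)
    have hd2 : dist y (H.anc j y) ≤ 4 / 3 * (θ * s ^ i) := H.dist_portalNode hs hθ hθ1 hi.le y
    have hpos : 0 < s ^ i := by positivity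
    have : θ * s ^ i ≤ 1 * s ^ i := by gcongr
    linarith [dist_triangle_left (H.anc j y) x y]

/-! ### Counting active portals -/

/-- The active portals of a cluster. -/
def activeSet (H : NetTree X s L) (ord : ℕ → X → ℕ) (h : H.Idx → ℝ) (F : MGraph (Portal X)) (i : ℕ)
    (C : Set X) : Set (Portal X) :=
  {p | p.height = i ∧ p.cluster = C ∧ H.IsActive ord h F p}

lemma activeSet_finite {T : MGraph X} (i : ℕ) (C : Set X) :
    (H.activeSet ord h (H.reroute θ (H.clusterOf ord h) t T) i C).Finite := by
  refine (Set.finite_range fun x : X => (⟨i, C, H.portalNode θ i x⟩ : Portal X)).subset ?_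
  rintro p ⟨rfl, rfl, hp⟩
  obtain ⟨x, y, -, -, hpx⟩ := hp.exists_routeVertex
  rw [hpx]
  exact ⟨_, rfl⟩

/-- If all edges are routed through the hubs, then only the hubs are active. -/
lemma activeSet_ncard_le_one {T : MGraph X} (hs : 4 ≤ s) (hh : H.Admissible h) (i : ℕ)
    (C : Set X) : (H.activeSet ord h (H.reroute θ (H.clusterOf ord h) 0 T) i C).ncard ≤ 1 := by
  rw [Set.ncard_le_one (activeSet_finite i C)]
  rintro p ⟨rfl, rfl, hp⟩ p' ⟨h1, h2, hp'⟩
  obtain ⟨x, y, -, hlt, hpx⟩ := hp.exists_routeVertex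
  obtain ⟨x', y', -, hlt', hpx'⟩ := hp'.exists_routeVertex
  rw [h1] at hlt' hpx'
  have hC : p.cluster = H.clusterOf ord h p.height x := by rw [hpx]; rfl
  have hC' : p.cluster = H.clusterOf ord h p.height x' := by rw [← h2, hpx']; rfl
  rw [hpx, hpx']
  simp only [routeVertex,
    if_neg (show ¬ mergeHeight (H.clusterOf ord h) x y ≤ p.height + 0 by omega),
    if_neg (show ¬ mergeHeight (H.clusterOf ord h) x' y' ≤ p.height + 0 by omega)]
  rw [← hC, ← hC', hub_eq (hC ▸ mem_clusterOf_self hs hh p.height x) x x']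

open Classical in
/-- The edges counted by `numCut`. -/
noncomputable def cutEdges (F : MGraph X) (ℓ : ℝ) (u : X) (ρ : ℝ) : MGraph X :=
  F.filter fun e => edgeLen e ≤ ℓ ∧
    (∃ x ∈ e, x ∈ Metric.closedBall u ρ) ∧ ∃ y ∈ e, y ∉ Metric.closedBall u ρ

/-- Good radii leave few active portals. The active portals of a cluster `C` other than its hub
belong to edges leaving `C` that are separated at one of the `t` heights `i, …, i + t - 1`. The
short ones are cut by one of the boundedly many balls of that height near `C`; the long ones have
their ends in a net, since `T` is net-respecting. -/
lemma activeSet_ncard_le {T : MGraph X} {ε q' : ℝ} (hs : 4 ≤ s)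
    (hX : ∀ x y : X, x ≠ y → 1 ≤ dist x y) (hD : DoublingDimLE X k) (hk : 0 ≤ k)
    (hh : H.Admissible h) (hord : ∀ i ≤ L, Set.InjOn (ord i) (H.N i : Set X)) (hε : 0 < ε)
    (hε1 : ε ≤ 1) (hq : 0 ≤ q') (hT : H.NetRespecting ε T)
    (hgood : h ∈ H.goodEvent T q') {i : ℕ} {C : Set X} (hC : H.IsCluster ord h i C) :
    ((H.activeSet ord h (H.reroute θ (H.clusterOf ord h) t T) i C).ncard : ℝ) ≤
      t * (56 ^ k * q') + (1 + (48 * (s / ε)) ^ k) := by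
  classical
  obtain ⟨hi, x₀, rfl⟩ := hC
  set C := H.clusterOf ord h i x₀ with hCdef
  have hs1 : 1 < s := by linarith
  have hse : 1 ≤ s / ε := by rw [le_div_iff₀ hε]; linarith
  have hC4 : ∀ y ∈ C, dist y x₀ ≤ 4 * s ^ i := fun y hy => dist_le_of_mem_clusterOf hs hh hi hy
  have hpi : 0 < s ^ i := by positivity
  have hnn : 0 ≤ t * (56 ^ k * q') := by positivity
  -- the portal next to `x`
  let P : X → Portal X := fun x => ⟨i, C, H.portalNode θ i x⟩
  have hact : ∀ p ∈ H.activeSet ord h (H.reroute θ (H.clusterOf ord h) t T) i C,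
      p = P (hub C x₀) ∨ ∃ x y, s(x, y) ∈ T ∧ x ∈ C ∧ p = P x ∧
        i < mergeHeight (H.clusterOf ord h) x y ∧
        mergeHeight (H.clusterOf ord h) x y ≤ i + t := by
    rintro p ⟨h1, h2, hp⟩
    obtain ⟨x, y, hxy, hlt, hpx⟩ := hp.exists_routeVertex
    rw [h1] at hlt hpx
    have hCx : H.clusterOf ord h i x = C := by rw [← h2, hpx]; rfl
    have hxC : x ∈ C := hCx ▸ mem_clusterOf_self hs hh i x
    rw [hpx, routeVertex, hCx]
    split_ifs with ht
    · exact Or.inr ⟨x, y, hxy, hxC, rfl, hlt, ht⟩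
    · left
      rw [hub_eq hxC x x₀]
  rcases Nat.eq_zero_or_pos i with rfl | hi0
  · -- a cluster of height `0` has few points
    have hsub : H.activeSet ord h (H.reroute θ (H.clusterOf ord h) t T) 0 C ⊆
        ((C.toFinset.image P : Finset _) : Set (Portal X)) := by
      intro p hp
      rw [Finset.coe_image]
      rcases hact p hp with rfl | ⟨x, -, -, hxC, rfl, -⟩
      · exact ⟨_, by simpa using hub_mem (mem_clusterOf_self hs hh 0 x₀) x₀, rfl⟩
      · exact ⟨_, by simpa using hxC, rfl⟩
    have h1 := (Set.ncard_le_ncard hsub (Finset.finite_toSet _)).trans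
      ((Set.ncard_coe_finset _).trans_le Finset.card_image_le)
    have h2 := card_near_le (H := H) hs hX hD hk (Nat.zero_le L) (R := 6) (by norm_num)
      (S := C.toFinset) (by simp [H.N_zero]) (x := x₀) (fun y hy => by
        have := hC4 y (by simpa using hy)
        norm_num at this
        linarith)
    have h3 : (8 * 6 / s ^ 0 : ℝ) ^ k ≤ (48 * (s / ε)) ^ k :=
      Real.rpow_le_rpow (by norm_num) (by norm_num; linarith) hk
    have h4 : ((H.activeSet ord h (H.reroute θ (H.clusterOf ord h) t T) 0 C).ncard : ℝ) ≤
      (C.toFinset.card : ℝ) := by exact_mod_cast h1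
    linarith
  · -- the end in `C` of an edge leaving `C`
    let g : Sym2 X → X := fun e => if he : ∃ z ∈ e, z ∈ C then he.choose else x₀
    have hg : ∀ x y, x ∈ C → y ∉ C → g s(x, y) = x := by
      intro x y hx hy
      have he : ∃ z ∈ s(x, y), z ∈ C := ⟨x, Sym2.mem_mk_left x y, hx⟩
      have h1 := he.choose_spec
      simp only [g, dif_pos he]
      rcases Sym2.mem_iff.1 h1.1 with h2 | h2
      · exact h2
      · exact absurd (h2 ▸ h1.2) hy
    let A : ℕ → Finset X := fun j => (H.N j).filter fun u => dist u x₀ ≤ 7 * s ^ j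
    let B : Finset (Portal X) := (Finset.Ico i (min (i + t) L)).biUnion fun j =>
      (A j).biUnion fun u =>
        ((cutEdges T (s ^ j) u (H.radius h j u)).toFinset.image fun e => P (g e))
    let D : Finset X := C.toFinset.filter fun x => x ∈ H.N (portalLevel s ε i).toNat
    have hsub : H.activeSet ord h (H.reroute θ (H.clusterOf ord h) t T) i C ⊆
        ((B ∪ ({P (hub C x₀)} ∪ D.image P) : Finset _) : Set (Portal X)) := by
      intro p hp
      rw [Finset.mem_coe, Finset.mem_union, Finset.mem_union, Finset.mem_singleton]
      rcases hact p hp with rfl | ⟨x, y, hxy, hxC, rfl, hlt, hle⟩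
      · exact Or.inr (Or.inl rfl)
      · have hκL := mergeHeight_le (H := H) (ord := ord) (h := h) x y
        obtain ⟨j, hj⟩ : ∃ j, mergeHeight (H.clusterOf ord h) x y = j + 1 :=
          ⟨_, (Nat.succ_pred_eq_of_pos (by omega)).symm⟩
        have hij : i ≤ j := by omega
        have hpij : s ^ i ≤ s ^ j := pow_le_pow_right₀ hs1.le hij
        have hyC : y ∉ C := by
          intro hy
          have h1 := clusterOf_eq_of_mem hord hy
          have h2 := clusterOf_eq_of_mem hord hxC
          exact cluster_ne_of_lt_mergeHeight hlt (h2.trans h1.symm)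
        rcases le_or_gt (dist x y) (s ^ j) with hd | hd
        · left
          have hsep : H.Separated ord h j x y := by
            refine separated_of_ne hs hh hord (cluster_ne_of_lt_mergeHeight (by omega)) ?_
            rw [← hj]
            exact cluster_mergeHeight x y
          obtain ⟨u, hu, hcut, -⟩ := hsep.exists_cut hs hh (by omega)
          have hrad := (hh.radius_mem hs j u).2
          have hmem : s(x, y) ∈ cutEdges T (s ^ j) u (H.radius h j u) := by
            refine Multiset.mem_filter.2 ⟨hxy, hd, ?_⟩
            rcases hcut with ⟨h1, h2⟩ | ⟨h1, h2⟩
            · exact ⟨⟨x, by simp, h1⟩, ⟨y, by simp, h2⟩⟩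
            · exact ⟨⟨y, by simp, h1⟩, ⟨x, by simp, h2⟩⟩
          have hxu : dist x u ≤ 3 * s ^ j := by
            rcases hcut with ⟨h1, -⟩ | ⟨h1, -⟩
            · rw [Metric.mem_closedBall] at h1
              have : 0 < s ^ j := by positivity
              linarith
            · rw [Metric.mem_closedBall] at h1
              linarith [dist_triangle x y u]
          refine Finset.mem_biUnion.2 ⟨j, Finset.mem_Ico.2 ⟨hij, by omega⟩,
            Finset.mem_biUnion.2 ⟨u, Finset.mem_filter.2 ⟨hu, ?_⟩, Finset.mem_image.2
              ⟨s(x, y), Multiset.mem_toFinset.2 hmem, by rw [hg x y hxC hyC]⟩⟩⟩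
          linarith [hC4 x hxC, dist_triangle_left u x₀ x]
        · right; right
          have hdpos : 0 < ε * dist x y := by
            have : 0 < s ^ j := by positivity
            have : 0 < dist x y := by linarith
            positivity
          obtain ⟨l, hl1, hl2⟩ := exists_mem_Ico_zpow hdpos hs1
          have hxN := hT _ hxy l hl1 hl2 x (Sym2.mem_mk_left x y)
          have hlow : portalLevel s ε i ≤ l := by
            have h1 := (portalLevel_spec hs hε i).1
            have h2 : ε * s ^ i < ε * dist x y := by gcongr; linarith
            have h3 := (zpow_lt_zpow_iff_right₀ hs1).1 ((h1.trans_lt h2).trans hl2)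
            omega
          have hup : l ≤ L := by
            have h1 := H.dist_le_top x y
            have h2 : ε * dist x y ≤ 1 * (2 * s ^ L) := by gcongr
            have h3 : (1 : ℝ) * (2 * s ^ L) < s ^ ((L : ℤ) + 1) := by
              rw [zpow_add₀ (by linarith), zpow_one, zpow_natCast]
              have : 0 < s ^ L := by positivity
              nlinarith
            have h4 := (zpow_lt_zpow_iff_right₀ hs1).1 (hl1.trans_lt (h2.trans_lt h3))
            omega
          refine Finset.mem_image.2 ⟨x, Finset.mem_filter.2 ⟨by simpa using hxC, ?_⟩, rfl⟩
          exact H.N_anti (by omega) (by omega) hxN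
    have hD' : (D.card : ℝ) ≤ (48 * (s / ε)) ^ k := by
      refine card_near_portalLevel_le (H := H) hs hX hD hk hε hε1 hi.le (x := x₀) ?_ ?_
      · exact fun x hx => (Finset.mem_filter.1 hx).2
      · intro x hx
        have := hC4 x (by simpa using (Finset.mem_filter.1 hx).1)
        linarith
    have hB : (B.card : ℝ) ≤ t * (56 ^ k * q') := by
      have hcut : ∀ j ∈ Finset.Ico i (min (i + t) L), ∀ u ∈ A j,
          (((cutEdges T (s ^ j) u (H.radius h j u)).toFinset.image fun e => P (g e)).card : ℝ)
            ≤ q' := by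
        intro j hj u hu
        rw [Finset.mem_Ico] at hj
        refine le_trans ?_ (hgood j (by omega) (by omega) u (Finset.mem_filter.1 hu).1)
        exact_mod_cast Finset.card_image_le.trans (Multiset.toFinset_card_le _)
      have hA : ∀ j ∈ Finset.Ico i (min (i + t) L), ((A j).card : ℝ) ≤ 56 ^ k := by
        intro j hj
        rw [Finset.mem_Ico] at hj
        have hpj : 0 < s ^ j := by positivity
        have := card_near_le (H := H) hs hX hD hk (j := j) (by omega) (R := 7 * s ^ j)
          (by linarith) (S := A j) (Finset.filter_subset _ _) (x := x₀)
          (fun y hy => (Finset.mem_filter.1 hy).2)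
        rwa [show 8 * (7 * s ^ j) / s ^ j = 56 by field_simp; norm_num] at this
      calc (B.card : ℝ) ≤ ∑ j ∈ Finset.Ico i (min (i + t) L), ∑ u ∈ A j,
            (((cutEdges T (s ^ j) u (H.radius h j u)).toFinset.image
              fun e => P (g e)).card : ℝ) := by
            have h1 := Finset.card_biUnion_le (s := Finset.Ico i (min (i + t) L))
              (t := fun j => (A j).biUnion fun u =>
                ((cutEdges T (s ^ j) u (H.radius h j u)).toFinset.image fun e => P (g e)))
            have h2 := h1.trans (Finset.sum_le_sum fun j _ => Finset.card_biUnion_le)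
            exact_mod_cast h2
        _ ≤ ∑ j ∈ Finset.Ico i (min (i + t) L), ∑ u ∈ A j, q' :=
            Finset.sum_le_sum fun j hj => Finset.sum_le_sum fun u hu => hcut j hj u hu
        _ = ∑ j ∈ Finset.Ico i (min (i + t) L), (A j).card * q' := by simp
        _ ≤ ∑ j ∈ Finset.Ico i (min (i + t) L), 56 ^ k * q' :=
            Finset.sum_le_sum fun j hj => mul_le_mul_of_nonneg_right (hA j hj) hq
        _ = (min (i + t) L - i : ℕ) * (56 ^ k * q') := by simp
        _ ≤ t * (56 ^ k * q') := by
            gcongr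
            omega
    have h1 : (H.activeSet ord h (H.reroute θ (H.clusterOf ord h) t T) i C).ncard ≤
        B.card + (1 + D.card) := by
      refine (Set.ncard_le_ncard hsub (Finset.finite_toSet _)).trans ?_
      rw [Set.ncard_coe_finset]
      refine (Finset.card_union_le _ _).trans ?_
      gcongr
      refine (Finset.card_union_le _ _).trans ?_
      rw [Finset.card_singleton]
      gcongr
      exact Finset.card_image_le
    have h2 : ((H.activeSet ord h (H.reroute θ (H.clusterOf ord h) t T) i C).ncard : ℝ) ≤
        B.card + (1 + D.card) := by exact_mod_cast h1
    linarith

end NetTree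

/-! ### The truncated exponential law -/

section TruncExp

variable {χ σ : ℝ}

/-- The density of the truncated exponential law on its support. -/
noncomputable def truncDensity (χ σ t : ℝ) : ℝ :=
  χ / (χ - 1) * (Real.log χ / σ) * Real.exp (-(t * Real.log χ / σ))

lemma truncDensity_nonneg (hχ : 1 < χ) (hσ : 0 < σ) (t : ℝ) : 0 ≤ truncDensity χ σ t := by
  have h1 : 0 < χ - 1 := by linarith
  have h2 := Real.log_pos hχ
  rw [truncDensity]
  positivity

lemma truncDensity_anti (hχ : 1 < χ) (hσ : 0 < σ) {t t' : ℝ} (h : t ≤ t') :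
    truncDensity χ σ t' ≤ truncDensity χ σ t := by
  have h1 : 0 < χ - 1 := by linarith
  have h2 := Real.log_pos hχ
  rw [truncDensity, truncDensity]
  gcongr

lemma truncExp_apply (S : Set ℝ) (hS : MeasurableSet S) :
    truncExp χ σ S = ∫⁻ t in S ∩ Set.Icc 0 σ, ENNReal.ofReal (truncDensity χ σ t) := by
  rw [truncExp, withDensity_apply _ hS, Set.inter_comm,
    ← Measure.restrict_restrict measurableSet_Icc, ← lintegral_indicator measurableSet_Icc]
  refine lintegral_congr fun t => ?_
  by_cases ht : t ∈ Set.Icc 0 σ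
  · simp [Set.indicator_of_mem ht, truncDensity]
  · simp [Set.indicator_of_notMem ht]

lemma truncExp_le (hχ : 1 < χ) (hσ : 0 < σ) {S : Set ℝ} (hS : MeasurableSet S) {α : ℝ}
    (hα : S ∩ Set.Icc 0 σ ⊆ Set.Ici α) :
    truncExp χ σ S ≤ ENNReal.ofReal (truncDensity χ σ α) * volume (S ∩ Set.Icc 0 σ) := by
  rw [truncExp_apply S hS, ← setLIntegral_const]
  exact setLIntegral_mono measurable_const fun t ht =>
    ENNReal.ofReal_le_ofReal (truncDensity_anti hχ hσ (hα ht))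

lemma truncExp_compl_Icc : truncExp χ σ (Set.Icc 0 σ)ᶜ = 0 := by
  rw [truncExp_apply _ measurableSet_Icc.compl]
  simp

lemma truncExp_Icc (hχ : 1 < χ) (hσ : 0 < σ) {α : ℝ} (hα : 0 ≤ α) (hασ : α ≤ σ) :
    truncExp χ σ (Set.Icc α σ) =
      ENNReal.ofReal (χ / (χ - 1) * (Real.exp (-(α * Real.log χ / σ)) - 1 / χ)) := by
  have h1 : χ - 1 ≠ 0 := by linarith
  have hcont : Continuous (truncDensity χ σ) := by unfold truncDensity; fun_prop
  rw [truncExp_apply _ measurableSet_Icc,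
    Set.inter_eq_left.2 (Set.Icc_subset_Icc_left hα),
    ← ofReal_integral_eq_lintegral_ofReal hcont.integrableOn_Icc
      (Filter.Eventually.of_forall (truncDensity_nonneg hχ hσ)),
    integral_Icc_eq_integral_Ioc, ← intervalIntegral.integral_of_le hασ]
  congr 1
  have hderiv : ∀ t ∈ Set.uIcc α σ, HasDerivAt
      (fun t => -(χ / (χ - 1)) * Real.exp (-(t * Real.log χ / σ))) (truncDensity χ σ t) t := by
    intro t _
    have h2 : HasDerivAt (fun t : ℝ => -(t * Real.log χ / σ)) (-(1 * Real.log χ / σ)) t :=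
      (((hasDerivAt_id t).mul_const _).div_const _).neg
    refine (h2.exp.const_mul (-(χ / (χ - 1)))).congr_deriv ?_
    unfold truncDensity
    ring
  rw [intervalIntegral.integral_eq_sub_of_hasDerivAt hderiv (hcont.intervalIntegrable _ _)]
  have h3 : Real.exp (-(σ * Real.log χ / σ)) = 1 / χ := by
    rw [mul_div_cancel_left₀ _ hσ.ne', Real.exp_neg, Real.exp_log (by linarith), one_div]
  rw [h3]
  ring

lemma isProbabilityMeasure_truncExp (hχ : 1 < χ) (hσ : 0 < σ) :
    IsProbabilityMeasure (truncExp χ σ) := by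
  constructor
  have h := measure_add_measure_compl (μ := truncExp χ σ) (measurableSet_Icc (a := 0) (b := σ))
  rw [truncExp_compl_Icc, add_zero, truncExp_Icc hχ hσ le_rfl hσ.le] at h
  rw [← h, ← ENNReal.ofReal_one]
  congr 1
  have h1 : χ - 1 ≠ 0 := by linarith
  have h2 : χ ≠ 0 := by linarith
  simp only [zero_mul, zero_div, neg_zero, Real.exp_zero]
  field_simp

/-- Removing a set of small Lebesgue measure removes at most half of the exponential part of any
tail. -/
lemma truncExp_tail_ge (hχ : 1 < χ) (hσ : 0 < σ) {G : Set ℝ} (hG : MeasurableSet G) {δ : ℝ}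
    (hδ0 : 0 ≤ δ) (hδ : Real.log χ / σ * δ ≤ 1 / 2)
    (hvol : volume (Set.Icc 0 σ \ G) ≤ ENNReal.ofReal δ) {α : ℝ} (hα : 0 ≤ α) (hασ : α ≤ σ) :
    χ / (χ - 1) * (Real.exp (-(α * Real.log χ / σ)) / 2 - 1 / χ) ≤
      (truncExp χ σ).real (G ∩ Set.Ici α) := by
  have := isProbabilityMeasure_truncExp hχ hσ
  have hχ1 : 0 < χ - 1 := by linarith
  have hχ0 : 0 < χ := by linarith
  have hlog := Real.log_pos hχ
  have hbad : (truncExp χ σ).real (Set.Icc α σ \ G) ≤ truncDensity χ σ α * δ := by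
    refine ENNReal.toReal_le_of_le_ofReal
      (mul_nonneg (truncDensity_nonneg hχ hσ α) hδ0) ?_
    refine (truncExp_le hχ hσ (measurableSet_Icc.diff hG) fun t ht => ht.1.1.1).trans ?_
    rw [ENNReal.ofReal_mul (truncDensity_nonneg hχ hσ α)]
    gcongr
    refine (measure_mono ?_).trans hvol
    exact fun t ht => ⟨ht.2, ht.1.2⟩
  have htot : (truncExp χ σ).real (Set.Icc α σ) =
      χ / (χ - 1) * (Real.exp (-(α * Real.log χ / σ)) - 1 / χ) := by
    rw [measureReal_def, truncExp_Icc hχ hσ hα hασ, ENNReal.toReal_ofReal]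
    refine mul_nonneg (by positivity) ?_
    have h1 : Real.log (1 / χ) ≤ -(α * Real.log χ / σ) := by
      rw [one_div, Real.log_inv, neg_le_neg_iff, div_le_iff₀ hσ, mul_comm]
      gcongr
    have h2 := Real.exp_le_exp.2 h1
    rw [Real.exp_log (by positivity)] at h2
    linarith
  have hsplit : (truncExp χ σ).real (Set.Icc α σ) ≤
      (truncExp χ σ).real (G ∩ Set.Ici α) + (truncExp χ σ).real (Set.Icc α σ \ G) := by
    refine (measureReal_mono ?_).trans (measureReal_union_le _ _)
    intro t ht
    by_cases htG : t ∈ G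
    · exact Or.inl ⟨htG, ht.1⟩
    · exact Or.inr ⟨ht, htG⟩
  have hdens : truncDensity χ σ α * δ ≤
      χ / (χ - 1) * (Real.exp (-(α * Real.log χ / σ)) / 2) := by
    calc truncDensity χ σ α * δ = χ / (χ - 1) * Real.exp (-(α * Real.log χ / σ)) *
          (Real.log χ / σ * δ) := by rw [truncDensity]; ring
      _ ≤ χ / (χ - 1) * Real.exp (-(α * Real.log χ / σ)) * (1 / 2) := by gcongr
      _ = _ := by ring
  rw [mul_sub] at htot ⊢
  linarith

lemma truncExp_good_ge (hχ : 4 ≤ χ) (hσ : 0 < σ) {G : Set ℝ} (hG : MeasurableSet G) {δ : ℝ}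
    (hδ0 : 0 ≤ δ) (hδ : Real.log χ / σ * δ ≤ 1 / 2)
    (hvol : volume (Set.Icc 0 σ \ G) ≤ ENNReal.ofReal δ) :
    1 / 4 ≤ (truncExp χ σ).real G := by
  have := isProbabilityMeasure_truncExp (by linarith : 1 < χ) hσ
  have h := truncExp_tail_ge (by linarith) hσ hG hδ0 hδ hvol le_rfl hσ.le
  have h1 : (truncExp χ σ).real (G ∩ Set.Ici 0) ≤ (truncExp χ σ).real G :=
    measureReal_mono Set.inter_subset_left
  have hχ1 : 0 < χ - 1 := by linarith
  have hχ0 : 0 < χ := by linarith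
  refine le_trans ?_ (h.trans h1)
  simp only [zero_mul, zero_div, neg_zero, Real.exp_zero]
  have h2 : χ * (1 / 2 - 1 / χ) = χ / 2 - 1 := by field_simp
  rw [div_mul_eq_mul_div, le_div_iff₀ hχ1, h2]
  linarith

/-- The law conditioned on a set of radii that misses little of `[0, σ]` is, up to constants and the
truncation error, memoryless at rate `log χ / σ`. -/
lemma cond_truncExp_Ico_le (hχ : 4 ≤ χ) (hσ : 0 < σ) {G : Set ℝ} (hG : MeasurableSet G) {δ : ℝ}
    (hδ0 : 0 ≤ δ) (hδ : Real.log χ / σ * δ ≤ 1 / 2)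
    (hvol : volume (Set.Icc 0 σ \ G) ≤ ENNReal.ofReal δ) {d : ℝ} (hd : 0 ≤ d) (α : ℝ) :
    (cond (truncExp χ σ) G).real (Set.Ico α (α + d)) ≤
      Real.log χ / σ * d *
        (2 * (cond (truncExp χ σ) G).real (Set.Ici α) + if α ≤ σ then 16 / χ else 0) := by
  have hχ' : 1 < χ := by linarith
  have := isProbabilityMeasure_truncExp hχ' hσ
  have hχ1 : 0 < χ - 1 := by linarith
  have hχ0 : 0 < χ := by linarith
  have hlog := Real.log_pos hχ'
  have hgood := truncExp_good_ge hχ hσ hG hδ0 hδ hvol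
  have hcond : ∀ S, (cond (truncExp χ σ) G).real S =
      (truncExp χ σ).real (G ∩ S) / (truncExp χ σ).real G := by
    intro S
    rw [measureReal_def, cond_apply hG, ENNReal.toReal_mul, ENNReal.toReal_inv, ← measureReal_def,
      ← measureReal_def, mul_comm, div_eq_mul_inv]
  have hnn : 0 ≤ (cond (truncExp χ σ) G).real (Set.Ici α) := measureReal_nonneg
  rw [hcond, div_le_iff₀ (by linarith)]
  split_ifs with hασ
  · set α' := max α 0
    have hα'σ : α' ≤ σ := max_le hασ hσ.le
    have htail := truncExp_tail_ge hχ' hσ hG hδ0 hδ hvol (le_max_right α 0) hα'σ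
    have hcut : (truncExp χ σ).real (G ∩ Set.Ico α (α + d)) ≤ truncDensity χ σ α' * d := by
      refine ENNReal.toReal_le_of_le_ofReal
        (mul_nonneg (truncDensity_nonneg hχ' hσ _) hd) ?_
      refine (truncExp_le hχ' hσ (hG.inter measurableSet_Ico)
        fun t ht => max_le ht.1.2.1 ht.2.1).trans ?_
      rw [ENNReal.ofReal_mul (truncDensity_nonneg hχ' hσ _)]
      gcongr
      refine (measure_mono (fun t ht => ht.1.2)).trans ?_
      rw [Real.volume_Ico]
      simp
    have hmono : (truncExp χ σ).real (G ∩ Set.Ici α') ≤ (truncExp χ σ).real (G ∩ Set.Ici α) :=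
      measureReal_mono (Set.inter_subset_inter_right _ (Set.Ici_subset_Ici.2 (le_max_left _ _)))
    have hI := hcond (Set.Ici α)
    rw [eq_div_iff (by linarith)] at hI
    have hD : χ / (χ - 1) * (1 / χ) ≤ 2 / χ := by
      rw [div_mul_div_comm, div_le_div_iff₀ (by positivity) (by positivity)]
      nlinarith
    have h4 : 4 / χ ≤ 16 / χ * (truncExp χ σ).real G := by
      have : 16 / χ * (1 / 4) ≤ 16 / χ * (truncExp χ σ).real G := by gcongr
      calc 4 / χ = 16 / χ * (1 / 4) := by ring
        _ ≤ _ := this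
    have hmain : χ / (χ - 1) * Real.exp (-(α' * Real.log χ / σ)) ≤
        (2 * (cond (truncExp χ σ) G).real (Set.Ici α) + 16 / χ) * (truncExp χ σ).real G := by
      rw [mul_sub, mul_div_assoc'] at htail
      have e : (4 : ℝ) / χ = 2 * (2 / χ) := by ring
      rw [add_mul, mul_assoc, hI]
      linarith
    calc _ ≤ truncDensity χ σ α' * d := hcut
      _ = Real.log χ / σ * d * (χ / (χ - 1) * Real.exp (-(α' * Real.log χ / σ))) := by
          rw [truncDensity]; ring
      _ ≤ Real.log χ / σ * d * ((2 * (cond (truncExp χ σ) G).real (Set.Ici α) + 16 / χ) *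
          (truncExp χ σ).real G) := by gcongr
      _ = _ := by ring
  · have h0 : (truncExp χ σ).real (G ∩ Set.Ico α (α + d)) = 0 := by
      refine measureReal_mono_null (s₂ := (Set.Icc 0 σ)ᶜ) ?_ ?_
      · exact fun t ht ht' => hασ (ht.2.1.trans ht'.2)
      · rw [measureReal_def, truncExp_compl_Icc, ENNReal.toReal_zero]
    rw [h0]
    positivity

end TruncExp

/-! ### Independent radii -/

section Product

variable {ι : Type u} [Fintype ι]

/-- Conditioning independent variables on a product event keeps them independent. -/
lemma cond_pi {Ω : ι → Type v} [∀ p, MeasurableSpace (Ω p)] (μ : ∀ p, Measure (Ω p))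
    [∀ p, IsProbabilityMeasure (μ p)] {G : ∀ p, Set (Ω p)} (hG : ∀ p, MeasurableSet (G p))
    (hG0 : ∀ p, μ p (G p) ≠ 0) :
    cond (Measure.pi μ) (Set.pi Set.univ G) = Measure.pi fun p => cond (μ p) (G p) := by
  have : ∀ p, IsProbabilityMeasure (cond (μ p) (G p)) := fun p =>
    cond_isProbabilityMeasure (hG0 p)
  refine (Measure.pi_eq fun S _ => ?_).symm
  rw [cond_apply (MeasurableSet.univ_pi hG), ← Set.pi_inter_distrib, Measure.pi_pi, Measure.pi_pi]
  simp_rw [cond_apply (hG _)]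
  rw [Finset.prod_mul_distrib, ENNReal.prod_inv_distrib]
  exact fun p _ q _ _ => Or.inr (measure_ne_top _ _)

/-- Independent variables are inspected in the order of `r`, and `p` hits if its value is at least
`α p`. If hits within `[α p, α p + d)` are rare among the hits of each `p`, up to an error `δ p`,
then the first hit is rarely of this kind. -/
lemma first_hit_le (ν : ι → Measure ℝ) [∀ p, IsProbabilityMeasure (ν p)] (N : Finset ι)
    (r : ι → ℕ) (hr : Set.InjOn r (N : Set ι)) (α δ : ι → ℝ) (d M : ℝ) (hM : 0 ≤ M)
    (hδ : ∀ p ∈ N, 0 ≤ δ p)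
    (hν : ∀ p ∈ N, (ν p).real (Set.Ico (α p) (α p + d)) ≤
      M * (2 * (ν p).real (Set.Ici (α p)) + δ p)) :
    (Measure.pi ν).real {h | ∃ p ∈ N, h p ∈ Set.Ico (α p) (α p + d) ∧
        ∀ p' ∈ N, r p' < r p → h p' < α p'} ≤ M * (2 + ∑ p ∈ N, δ p) := by
  classical
  -- the event that the value of `p` is in `S` and that nothing hits before `p`
  let box : ι → Set ℝ → Set (ι → ℝ) := fun p S => Set.pi Set.univ fun p' =>
    if p' = p then S else if p' ∈ N ∧ r p' < r p then Set.Iio (α p') else Set.univ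
  have hmem : ∀ p S h, h ∈ box p S ↔ h p ∈ S ∧ ∀ p' ∈ N, r p' < r p → h p' < α p' := by
    intro p S h
    simp only [box, Set.mem_pi, Set.mem_univ, true_implies]
    constructor
    · intro hb
      refine ⟨by simpa using hb p, fun p' hp' hlt => ?_⟩
      have := hb p'
      rw [if_neg (by rintro rfl; exact lt_irrefl _ hlt), if_pos ⟨hp', hlt⟩] at this
      exact this
    · rintro ⟨h1, h2⟩ p'
      split_ifs with h3 h4
      · rwa [h3]
      · exact h2 p' h4.1 h4.2
      · trivial
  let c : ι → ℝ := fun p => ∏ p' ∈ Finset.univ.erase p,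
    (ν p').real (if p' ∈ N ∧ r p' < r p then Set.Iio (α p') else Set.univ)
  have hc0 : ∀ p, 0 ≤ c p := fun p => Finset.prod_nonneg fun _ _ => measureReal_nonneg
  have hc1 : ∀ p, c p ≤ 1 := fun p =>
    Finset.prod_le_one (fun _ _ => measureReal_nonneg) fun _ _ => measureReal_le_one
  have hbox : ∀ p S, (Measure.pi ν).real (box p S) = (ν p).real S * c p := by
    intro p S
    rw [measureReal_def, Measure.pi_pi, ENNReal.toReal_prod,
      ← Finset.mul_prod_erase _ _ (Finset.mem_univ p), if_pos rfl]
    congr 1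
    refine Finset.prod_congr rfl fun p' hp' => ?_
    rw [if_neg (Finset.ne_of_mem_erase hp')]
    rfl
  have hdisj : ((N : Set ι)).PairwiseDisjoint fun p => box p (Set.Ici (α p)) := by
    intro p hp p' hp' hne
    rw [Function.onFun, Set.disjoint_left]
    intro h h1 h2
    rw [hmem] at h1 h2
    rcases lt_trichotomy (r p) (r p') with hlt | heq | hlt
    · exact absurd (h2.2 p hp hlt) (not_lt.2 h1.1)
    · exact hne (hr hp hp' heq)
    · exact absurd (h1.2 p' hp' hlt) (not_lt.2 h2.1)
  have hmeas : ∀ p ∈ N, MeasurableSet (box p (Set.Ici (α p))) := by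
    intro p _
    refine MeasurableSet.univ_pi fun p' => ?_
    split_ifs
    · exact measurableSet_Ici
    · exact measurableSet_Iio
    · exact MeasurableSet.univ
  have hsum : ∑ p ∈ N, (Measure.pi ν).real (box p (Set.Ici (α p))) ≤ 1 := by
    rw [← measureReal_biUnion_finset hdisj hmeas]
    exact measureReal_le_one
  calc _ ≤ (Measure.pi ν).real (⋃ p ∈ N, box p (Set.Ico (α p) (α p + d))) := by
        refine measureReal_mono ?_ (measure_ne_top _ _)
        rintro h ⟨p, hp, h1, h2⟩
        exact Set.mem_iUnion₂.2 ⟨p, hp, (hmem _ _ _).2 ⟨h1, h2⟩⟩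
    _ ≤ ∑ p ∈ N, (Measure.pi ν).real (box p (Set.Ico (α p) (α p + d))) :=
        measureReal_biUnion_finset_le _ _
    _ = ∑ p ∈ N, (ν p).real (Set.Ico (α p) (α p + d)) * c p :=
        Finset.sum_congr rfl fun p _ => hbox p _
    _ ≤ ∑ p ∈ N, M * (2 * (Measure.pi ν).real (box p (Set.Ici (α p))) + δ p) := by
        refine Finset.sum_le_sum fun p hp => ?_
        rw [hbox]
        calc _ ≤ M * (2 * (ν p).real (Set.Ici (α p)) + δ p) * c p := by
              exact mul_le_mul_of_nonneg_right (hν p hp) (hc0 p)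
          _ = M * (2 * ((ν p).real (Set.Ici (α p)) * c p) + δ p * c p) := by ring
          _ ≤ M * (2 * ((ν p).real (Set.Ici (α p)) * c p) + δ p) := by
              gcongr
              exact mul_le_of_le_one_right (hδ p hp) (hc1 p)
    _ = M * (2 * (∑ p ∈ N, (Measure.pi ν).real (box p (Set.Ici (α p)))) + ∑ p ∈ N, δ p) := by
        rw [← Finset.mul_sum, Finset.sum_add_distrib, Finset.mul_sum]
    _ ≤ M * (2 * 1 + ∑ p ∈ N, δ p) := by gcongr
    _ = _ := by ring

end Product

/-! ### Good radii -/

section GoodRadii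

open NetTree

variable {X : Type u} [MetricSpace X]

/-- The shifts `τ` for which the ball `B(u, ℓ + τ)` cuts the edge `e`, of length at most `ℓ`. -/
def cutShifts (ℓ : ℝ) (u : X) (e : Sym2 X) : Set ℝ :=
  {τ | edgeLen e ≤ ℓ ∧ (∃ x ∈ e, x ∈ Metric.closedBall u (ℓ + τ)) ∧
    ∃ y ∈ e, y ∉ Metric.closedBall u (ℓ + τ)}

lemma cutShifts_mk {ℓ : ℝ} {u x y : X} (hxy : dist x y ≤ ℓ) :
    cutShifts ℓ u s(x, y) =
      Set.Ico (min (dist x u) (dist y u) - ℓ) (max (dist x u) (dist y u) - ℓ) := by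
  ext τ
  simp only [cutShifts, edgeLen_mk, hxy, true_and, Sym2.mem_iff, Metric.mem_closedBall,
    exists_eq_or_imp, exists_eq_left, Set.mem_ofPred_eq, Set.mem_Ico, not_le, sub_le_iff_le_add,
    lt_sub_iff_add_lt, min_le_iff, lt_max_iff, add_comm τ ℓ]

lemma measurableSet_cutShifts (ℓ : ℝ) (u : X) (e : Sym2 X) : MeasurableSet (cutShifts ℓ u e) := by
  induction e with
  | _ x y =>
    by_cases hxy : dist x y ≤ ℓ
    · rw [cutShifts_mk hxy]
      exact measurableSet_Ico
    · convert MeasurableSet.empty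
      exact Set.eq_empty_of_forall_notMem fun τ hτ => hxy hτ.1

lemma volume_cutShifts_le (ℓ : ℝ) (u : X) (e : Sym2 X) :
    volume (cutShifts ℓ u e) ≤ ENNReal.ofReal (edgeLen e) := by
  induction e with
  | _ x y =>
    by_cases hxy : dist x y ≤ ℓ
    · rw [cutShifts_mk hxy, Real.volume_Ico, edgeLen_mk]
      refine ENNReal.ofReal_le_ofReal ?_
      have h1 := abs_dist_sub_le x y u
      have h2 : max (dist x u) (dist y u) - min (dist x u) (dist y u) =
        |dist x u - dist y u| := by rw [max_sub_min_eq_abs', abs_sub_comm, abs_sub_comm]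
      linarith
    · have : cutShifts ℓ u s(x, y) = ∅ :=
        Set.eq_empty_of_forall_notMem fun τ hτ => hxy hτ.1
      simp [this]

variable [Fintype X]

open Classical in
lemma numCut_cons (e : Sym2 X) (F : MGraph X) (ℓ : ℝ) (u : X) (τ : ℝ) :
    numCut (e ::ₘ F) ℓ u (ℓ + τ) =
      (if τ ∈ cutShifts ℓ u e then 1 else 0) + numCut F ℓ u (ℓ + τ) := by
  rw [numCut, numCut, Multiset.filter_cons, Multiset.card_add]
  congr 1
  by_cases hτ : τ ∈ cutShifts ℓ u e
  · rw [if_pos hτ, if_pos (by exact hτ), Multiset.card_singleton]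
  · rw [if_neg hτ, if_neg (by exact hτ), Multiset.card_zero]

lemma measurable_numCut (F : MGraph X) (ℓ : ℝ) (u : X) :
    Measurable fun τ => numCut F ℓ u (ℓ + τ) := by
  classical
  induction F using Multiset.induction with
  | empty => simp [numCut]
  | cons e F ih =>
    simp only [numCut_cons]
    exact (Measurable.ite (measurableSet_cutShifts ℓ u e) measurable_const measurable_const).add ih

open Classical in
/-- On average over the radius, a ball cuts at most as many short edges as the weight near it. -/
lemma lintegral_numCut_le {ℓ : ℝ} (u : X) (F : MGraph X) :
    ∫⁻ τ in Set.Icc 0 ℓ, (numCut F ℓ u (ℓ + τ) : ENNReal) ≤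
      ENNReal.ofReal (weight (F.filter fun e => ∀ x ∈ e, x ∈ Metric.closedBall u (3 * ℓ))) := by
  induction F using Multiset.induction with
  | empty => simp [numCut]
  | cons e F ih =>
    have hmeas := measurableSet_cutShifts ℓ u e
    have h1 : ∀ τ, (numCut (e ::ₘ F) ℓ u (ℓ + τ) : ENNReal) =
        (cutShifts ℓ u e).indicator 1 τ + (numCut F ℓ u (ℓ + τ) : ENNReal) := by
      intro τ
      rw [numCut_cons, Nat.cast_add, Set.indicator_apply]
      split_ifs <;> simp
    simp_rw [h1]
    rw [lintegral_add_left (measurable_one.indicator hmeas), lintegral_indicator_one hmeas,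
      Measure.restrict_apply hmeas]
    by_cases he : ∀ x ∈ e, x ∈ Metric.closedBall u (3 * ℓ)
    · rw [Multiset.filter_cons_of_pos _ he, weight_cons,
        ENNReal.ofReal_add (edgeLen_nonneg e) (weight_nonneg _)]
      gcongr
      exact (measure_mono Set.inter_subset_left).trans (volume_cutShifts_le ℓ u e)
    · rw [Multiset.filter_cons_of_neg _ he]
      have : cutShifts ℓ u e ∩ Set.Icc 0 ℓ = ∅ := by
        -- a short edge that is cut by a ball of radius at most `2 ℓ` is near its center
        refine Set.eq_empty_of_forall_notMem ?_
        rintro τ ⟨⟨hlen, ⟨x, hx, hxu⟩, -⟩, hτ⟩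
        refine he fun z hz => ?_
        have hxz : dist z x ≤ ℓ := by
          obtain ⟨y, rfl⟩ := Sym2.mem_iff_exists.1 hx
          rw [edgeLen_mk] at hlen
          rcases Sym2.mem_iff.1 hz with rfl | rfl
          · rw [dist_self]; linarith [hτ.1, hτ.2]
          · rwa [dist_comm]
        rw [Metric.mem_closedBall] at hxu ⊢
        linarith [hτ.2, dist_triangle z x u]
      rw [this, measure_empty, zero_add]
      exact ih

/-- The shifts for which the ball cuts at most `A` edges of length at most `ℓ`. -/
def goodShifts (F : MGraph X) (ℓ : ℝ) (u : X) (A : ℝ) : Set ℝ :=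
  {τ | (numCut F ℓ u (ℓ + τ) : ℝ) ≤ A}

lemma measurableSet_goodShifts (F : MGraph X) (ℓ : ℝ) (u : X) (A : ℝ) :
    MeasurableSet (goodShifts F ℓ u A) := by
  have h1 : Measurable fun τ => (numCut F ℓ u (ℓ + τ) : ℝ) :=
    measurable_from_top.comp (measurable_numCut F ℓ u)
  exact measurableSet_le h1 measurable_const

open Classical in
lemma volume_bad_le {F : MGraph X} {ℓ q A : ℝ} (hℓ : 0 < ℓ) (hq : 0 ≤ q) (hA : 0 < A) {u : X}
    (hF : weight (F.filter fun e => ∀ x ∈ e, x ∈ Metric.closedBall u (3 * ℓ)) ≤ q * ℓ) :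
    volume (Set.Icc 0 ℓ \ goodShifts F ℓ u (A * q)) ≤ ENNReal.ofReal (ℓ / A) := by
  have hint := (lintegral_numCut_le u F).trans (ENNReal.ofReal_le_ofReal hF)
  have hmeas : Measurable fun τ => (numCut F ℓ u (ℓ + τ) : ENNReal) :=
    measurable_from_top.comp (measurable_numCut F ℓ u)
  -- a bad shift cuts at least one edge, and at least `A q` edges
  have hmarkov : ∀ c : ENNReal, (∀ n : ℕ, A * q < n → c ≤ n) →
      c * volume (Set.Icc 0 ℓ \ goodShifts F ℓ u (A * q)) ≤ ENNReal.ofReal (q * ℓ) := by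
    intro c hc
    refine le_trans ?_ ((mul_meas_ge_le_lintegral hmeas c).trans hint)
    rw [Measure.restrict_apply (measurableSet_le measurable_const hmeas)]
    gcongr
    exact fun τ hτ => ⟨hc _ (not_le.1 hτ.2), hτ.1⟩
  rcases hq.eq_or_lt with rfl | hq
  · have h1 := hmarkov 1 fun n hn => by
      rw [mul_zero, Nat.cast_pos] at hn
      exact_mod_cast hn
    rw [one_mul, zero_mul, ENNReal.ofReal_zero] at h1
    exact h1.trans zero_le
  · have h1 := hmarkov (ENNReal.ofReal (A * q)) fun n hn => by
      rw [← ENNReal.ofReal_natCast]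
      exact ENNReal.ofReal_le_ofReal hn.le
    have h2 : ENNReal.ofReal (q * ℓ) = ENNReal.ofReal (A * q) * ENNReal.ofReal (ℓ / A) := by
      rw [← ENNReal.ofReal_mul (by positivity)]
      congr 1
      field_simp
    rw [h2] at h1
    have hpos : 0 < A * q := by positivity
    exact (ENNReal.mul_le_mul_iff_right (by simpa using hpos) ENNReal.ofReal_ne_top).1 h1

end GoodRadii

namespace NetTree

variable {X : Type u} [MetricSpace X] [Fintype X] {s : ℝ} {L : ℕ} {H : NetTree X s L}

/-! ### The probability that a partition separates two points -/

/-- Under independent laws of the radii, conditioned on sets of radii of almost full measure, the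
partition of height `i` separates `x` and `y` with probability `O(log χ) d(x, y) / s ^ i`. -/
lemma prob_separated_le {k b : ℝ} (hs : 4 ≤ s) (hX : ∀ x y : X, x ≠ y → 1 ≤ dist x y)
    (hD : DoublingDimLE X k) (hk : 1 ≤ k) (hb : 32 ≤ b) {ord : ℕ → X → ℕ}
    (hord : ∀ i ≤ L, Set.InjOn (ord i) (H.N i : Set X)) {G : H.Idx → Set ℝ} {δ : H.Idx → ℝ}
    (hG : ∀ p, MeasurableSet (G p)) (hδ0 : ∀ p, 0 ≤ δ p)
    (hδ : ∀ p : H.Idx, Real.log (b ^ k) / s ^ (p.1 : ℕ) * δ p ≤ 1 / 2)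
    (hvol : ∀ p : H.Idx, volume (Set.Icc 0 (s ^ (p.1 : ℕ)) \ G p) ≤ ENNReal.ofReal (δ p))
    [∀ p : H.Idx, IsProbabilityMeasure (cond (truncExp (b ^ k) (s ^ (p.1 : ℕ))) (G p))]
    (hadm : ∀ᵐ h ∂(Measure.pi fun p : H.Idx => cond (truncExp (b ^ k) (s ^ (p.1 : ℕ))) (G p)),
      H.Admissible h) {i : ℕ} (hi : i ≤ L) (x y : X) :
    (Measure.pi fun p : H.Idx => cond (truncExp (b ^ k) (s ^ (p.1 : ℕ))) (G p)).real
      {h | H.Separated ord h i x y} ≤ 18 * (Real.log (b ^ k) / s ^ i * dist x y) := by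
  classical
  have hχ : 32 ^ k ≤ b ^ k := Real.rpow_le_rpow (by norm_num) hb (by linarith)
  have h32 : (32 : ℝ) ≤ 32 ^ k := by
    simpa using Real.rpow_le_rpow_of_exponent_le (by norm_num : (1 : ℝ) ≤ 32) hk
  have hχ4 : 4 ≤ b ^ k := by linarith
  have hlog := Real.log_pos (by linarith : 1 < b ^ k)
  have hσ : 0 < s ^ i := by positivity
  let N : Finset H.Idx := Finset.univ.filter fun p => (p.1 : ℕ) = i
  let α : H.Idx → ℝ := fun p => min (dist x p.2.1) (dist y p.2.1) - s ^ (p.1 : ℕ)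
  let r : H.Idx → ℕ := fun p => ord p.1 p.2.1
  have hN : ∀ p ∈ N, (p.1 : ℕ) = i := fun p hp => (Finset.mem_filter.1 hp).2
  have hinj : ∀ p ∈ N, ∀ p' ∈ N, p.2.1 = p'.2.1 → p = p' := by
    rintro ⟨j, w, hw⟩ hp ⟨j', w', hw'⟩ hp' hww
    obtain rfl : j = j' := Fin.ext ((hN _ hp).trans (hN _ hp').symm)
    obtain rfl : w = w' := hww
    rfl
  have hr : Set.InjOn r (N : Set H.Idx) := by
    intro p hp p' hp' hrr
    have h1 := hN p hp
    have h2 := hN p' hp'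
    refine hinj p hp p' hp' (hord i hi (h1 ▸ p.2.2) (h2 ▸ p'.2.2) ?_)
    simp only [r, h1, h2] at hrr
    exact hrr
  have hfirst := first_hit_le
    (fun p : H.Idx => cond (truncExp (b ^ k) (s ^ (p.1 : ℕ))) (G p)) N r hr α
    (fun p => if α p ≤ s ^ (p.1 : ℕ) then 16 / b ^ k else 0) (dist x y)
    (Real.log (b ^ k) / s ^ i * dist x y) (by positivity)
    (fun p _ => by split_ifs <;> positivity)
    (fun p hp => by
      have := cond_truncExp_Ico_le hχ4 (by positivity) (hG p) (hδ0 p) (hδ p) (hvol p)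
        (dist_nonneg (x := x) (y := y)) (α p)
      rwa [hN p hp] at this ⊢)
  -- only boundedly many balls can reach `x` or `y`
  have hnear : ∀ z : X, ((N.filter fun p => dist z p.2.1 ≤ 2 * s ^ i).card : ℝ) ≤ 16 ^ k := by
    intro z
    have h1 := card_near_le (H := H) hs hX hD (by linarith) hi (R := 2 * s ^ i) (by linarith)
      (S := (N.filter fun p => dist z p.2.1 ≤ 2 * s ^ i).image fun p => p.2.1) (x := z) ?_ ?_
    · rw [Finset.card_image_of_injOn, show 8 * (2 * s ^ i) / s ^ i = 16 by field_simp; norm_num]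
        at h1
      · exact h1
      · intro p hp p' hp'
        exact hinj p (Finset.mem_filter.1 hp).1 p' (Finset.mem_filter.1 hp').1
    · intro w hw
      obtain ⟨p, hp, rfl⟩ := Finset.mem_image.1 hw
      exact hN p (Finset.mem_filter.1 hp).1 ▸ p.2.2
    · intro w hw
      obtain ⟨p, hp, rfl⟩ := Finset.mem_image.1 hw
      rw [dist_comm]
      exact (Finset.mem_filter.1 hp).2
  have hsum : ∑ p ∈ N, (if α p ≤ s ^ (p.1 : ℕ) then 16 / b ^ k else 0) ≤ 16 := by
    rw [← Finset.sum_filter, Finset.sum_const, nsmul_eq_mul]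
    have hsub : (N.filter fun p => α p ≤ s ^ (p.1 : ℕ)) ⊆
        (N.filter fun p => dist x p.2.1 ≤ 2 * s ^ i) ∪
          N.filter fun p => dist y p.2.1 ≤ 2 * s ^ i := by
      intro p hp
      rw [Finset.mem_filter] at hp
      have h1 := hp.2
      simp only [α, hN p hp.1, sub_le_iff_le_add, min_le_iff] at h1
      rw [Finset.mem_union]
      rcases h1 with h1 | h1
      · exact Or.inl (Finset.mem_filter.2 ⟨hp.1, by linarith⟩)
      · exact Or.inr (Finset.mem_filter.2 ⟨hp.1, by linarith⟩)
    have h1 : ((N.filter fun p => α p ≤ s ^ (p.1 : ℕ)).card : ℝ) ≤ 16 ^ k + 16 ^ k := by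
      refine le_trans ?_ (add_le_add (hnear x) (hnear y))
      exact_mod_cast (Finset.card_le_card hsub).trans (Finset.card_union_le _ _)
    have h2 : (16 : ℝ) ^ k + 16 ^ k ≤ 32 ^ k := by
      rw [show (32 : ℝ) = 16 * 2 by norm_num, Real.mul_rpow (by norm_num) (by norm_num)]
      have h3 : (2 : ℝ) ≤ 2 ^ k := by
        simpa using Real.rpow_le_rpow_of_exponent_le (by norm_num : (1 : ℝ) ≤ 2) hk
      have h4 : (0 : ℝ) < 16 ^ k := by positivity
      nlinarith
    have hbk : 0 < b ^ k := by linarith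
    calc _ ≤ b ^ k * (16 / b ^ k) := by gcongr; linarith
      _ = 16 := by field_simp
  have hle : (Measure.pi fun p : H.Idx => cond (truncExp (b ^ k) (s ^ (p.1 : ℕ))) (G p)).real
      {h | H.Separated ord h i x y} ≤ Real.log (b ^ k) / s ^ i * dist x y *
        (2 + ∑ p ∈ N, if α p ≤ s ^ (p.1 : ℕ) then 16 / b ^ k else 0) := by
    refine le_trans (ENNReal.toReal_mono (measure_ne_top _ _) (measure_mono_ae ?_)) hfirst
    filter_upwards [hadm] with h hh hsep
    obtain ⟨u, hu, hcut, hbefore⟩ := Separated.exists_cut hs hh hi hsep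
    let p : H.Idx := ⟨⟨i, by omega⟩, ⟨u, hu⟩⟩
    refine ⟨p, Finset.mem_filter.2 ⟨Finset.mem_univ _, rfl⟩, ?_, ?_⟩
    · simp only [Metric.mem_closedBall, H.radius_eq h (Nat.lt_succ_of_le hi) hu, not_le] at hcut
      change min (dist x u) (dist y u) - s ^ i ≤ h p ∧
        h p < min (dist x u) (dist y u) - s ^ i + dist x y
      change (_ ≤ s ^ i + h p ∧ s ^ i + h p < _) ∨ (_ ≤ s ^ i + h p ∧ s ^ i + h p < _) at hcut
      have h1 := dist_triangle y x u
      have h2 := dist_triangle x y u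
      rw [dist_comm y x] at h1
      rcases hcut with hcut | hcut
      · rw [min_eq_left (by linarith)]
        constructor <;> linarith
      · rw [min_eq_right (by linarith)]
        constructor <;> linarith
    · intro p' hp' hlt
      have hi' := hN p' hp'
      obtain ⟨⟨j, hj⟩, v, hv⟩ := p'
      obtain rfl : j = i := hi'
      have h1 := hbefore v hv hlt
      simp only [Metric.mem_closedBall, H.radius_eq h hj hv, not_le] at h1
      change h _ < min (dist x v) (dist y v) - s ^ j
      rw [lt_sub_iff_add_lt, lt_min_iff, add_comm]
      exact h1
  refine hle.trans ?_
  rw [mul_comm (18 : ℝ)]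
  gcongr
  linarith

/-! ### Measurability -/

/-- Two families of radii define the same balls. -/
def SameBalls (H : NetTree X s L) (h h' : H.Idx → ℝ) : Prop :=
  ∀ (p : H.Idx) (x : X),
    dist x p.2.1 ≤ s ^ (p.1 : ℕ) + h p ↔ dist x p.2.1 ≤ s ^ (p.1 : ℕ) + h' p

/-- An event is measurable if it depends only on which points belong to which balls. -/
lemma measurableSet_of_sameBalls {S : Set (H.Idx → ℝ)}
    (hS : ∀ h h', H.SameBalls h h' → h ∈ S → h' ∈ S) : MeasurableSet S := by
  let D : (H.Idx → ℝ) → (H.Idx × X → Prop) := fun h p =>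
    dist p.2 p.1.2.1 ≤ s ^ (p.1.1 : ℕ) + h p.1
  have hD : Measurable D := by
    refine measurable_pi_iff.2 fun p => measurableSet_setOfPred.1 ?_
    exact measurableSet_le measurable_const (measurable_const.add (measurable_pi_apply _))
  have heq : S = D ⁻¹' (D '' S) := by
    refine Set.Subset.antisymm (Set.subset_preimage_image _ _) ?_
    rintro h ⟨h', hh', hDh⟩
    exact hS h' h (fun p x => iff_of_eq (congrFun hDh (p, x))) hh'
  rw [heq]
  exact hD (Set.toFinite _).measurableSet

lemma SameBalls.symm {h h' : H.Idx → ℝ} (hh : H.SameBalls h h') : H.SameBalls h' h :=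
  fun p x => (hh p x).symm

lemma SameBalls.mem_iff {h h' : H.Idx → ℝ} (hh : H.SameBalls h h') (i : ℕ) (u x : X) :
    x ∈ Metric.closedBall u (H.radius h i u) ↔ x ∈ Metric.closedBall u (H.radius h' i u) := by
  rw [radius, radius]
  split_ifs with hi hu
  · exact hh ⟨⟨i, hi⟩, ⟨u, hu⟩⟩ x
  · rfl
  · rfl

lemma SameBalls.isCenter_eq {h h' : H.Idx → ℝ} (hh : H.SameBalls h h') (ord : ℕ → X → ℕ) :
    H.IsCenter ord h = H.IsCenter ord h' := by
  funext i u x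
  simp only [IsCenter, hh.mem_iff]

lemma SameBalls.clusterOf_eq {h h' : H.Idx → ℝ} (hh : H.SameBalls h h') (ord : ℕ → X → ℕ) :
    H.clusterOf ord h = H.clusterOf ord h' := by
  funext i x
  simp only [clusterOf, hh.isCenter_eq ord]

lemma SameBalls.mem_goodEvent {h h' : H.Idx → ℝ} (hh : H.SameBalls h h') {T : MGraph X} {A : ℝ}
    (hmem : h ∈ H.goodEvent T A) : h' ∈ H.goodEvent T A := by
  intro i h1 h2 u hu
  have heq : numCut T (s ^ i) u (H.radius h' i u) = numCut T (s ^ i) u (H.radius h i u) := by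
    rw [numCut, numCut]
    classical
    refine congrArg Multiset.card (Multiset.filter_congr fun e _ => ?_)
    simp only [hh.mem_iff]
  rw [heq]
  exact hmem i h1 h2 u hu

lemma measurableSet_separated (ord : ℕ → X → ℕ) (i : ℕ) (x y : X) :
    MeasurableSet {h : H.Idx → ℝ | H.Separated ord h i x y} := by
  refine measurableSet_of_sameBalls fun h h' hh hsep => ?_
  simpa only [Set.mem_ofPred_eq, Separated, hh.isCenter_eq ord] using hsep

/-! ### The expected detour -/

lemma sepCost_mk (ord : ℕ → X → ℕ) (x y : X) (h : H.Idx → ℝ) :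
    H.sepCost ord h s(x, y) = ∑ i ∈ Finset.range L,
      {h : H.Idx → ℝ | H.Separated ord h i x y}.indicator (fun _ => s ^ i) h := by
  classical
  simp only [sepCost, Sym2.lift_mk, Set.indicator_apply, Set.mem_ofPred_eq]

lemma sepCost_nonneg (hs : 4 ≤ s) (ord : ℕ → X → ℕ) (h : H.Idx → ℝ) (e : Sym2 X) :
    0 ≤ H.sepCost ord h e := by
  induction e with
  | _ x y =>
    rw [sepCost_mk]
    exact Finset.sum_nonneg fun i _ => Set.indicator_nonneg (fun _ _ => by positivity) _

lemma measurable_sepCost (ord : ℕ → X → ℕ) (e : Sym2 X) :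
    Measurable fun h : H.Idx → ℝ => H.sepCost ord h e := by
  induction e with
  | _ x y =>
    simp only [sepCost_mk]
    exact Finset.measurable_sum _ fun i _ =>
      measurable_const.indicator (measurableSet_separated ord i x y)

lemma lintegral_sepCost_le {P : Measure (H.Idx → ℝ)} [IsProbabilityMeasure P] {M : ℝ}
    (hs : 4 ≤ s) {ord : ℕ → X → ℕ}
    (hP : ∀ i < L, ∀ x y : X, P.real {h | H.Separated ord h i x y} ≤ M / s ^ i * dist x y)
    (e : Sym2 X) :
    ∫⁻ h, ENNReal.ofReal (H.sepCost ord h e) ∂P ≤ ENNReal.ofReal (L * M * edgeLen e) := by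
  induction e with
  | _ x y =>
    have h1 : ∀ h : H.Idx → ℝ, ENNReal.ofReal (H.sepCost ord h s(x, y)) =
        ∑ i ∈ Finset.range L, {h : H.Idx → ℝ | H.Separated ord h i x y}.indicator
          (fun _ => ENNReal.ofReal (s ^ i)) h := by
      intro h
      classical
      rw [sepCost_mk, ENNReal.ofReal_sum_of_nonneg
        fun i _ => Set.indicator_nonneg (fun _ _ => by positivity) _]
      refine Finset.sum_congr rfl fun i _ => ?_
      rw [Set.indicator_apply, Set.indicator_apply]
      split_ifs <;> simp
    simp_rw [h1]
    rw [lintegral_finsetSum _ fun i _ =>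
      measurable_const.indicator (measurableSet_separated ord i x y)]
    calc _ ≤ ∑ i ∈ Finset.range L, ENNReal.ofReal (M * dist x y) := by
          refine Finset.sum_le_sum fun i hi => ?_
          have hpi : 0 < s ^ i := by positivity
          rw [lintegral_indicator_const (measurableSet_separated ord i x y),
            ← ofReal_measureReal, ← ENNReal.ofReal_mul hpi.le]
          refine ENNReal.ofReal_le_ofReal ?_
          calc _ ≤ s ^ i * (M / s ^ i * dist x y) := by
                gcongr
                exact hP i (Finset.mem_range.1 hi) x y
            _ = M * dist x y := by field_simp
      _ = ENNReal.ofReal (L * M * edgeLen s(x, y)) := by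
          rw [Finset.sum_const, Finset.card_range, nsmul_eq_mul, edgeLen_mk, mul_assoc,
            ENNReal.ofReal_mul (Nat.cast_nonneg L), ENNReal.ofReal_natCast]

lemma lintegral_sum_sepCost_le {P : Measure (H.Idx → ℝ)} [IsProbabilityMeasure P] {M : ℝ}
    (hs : 4 ≤ s) {ord : ℕ → X → ℕ} (hM : 0 ≤ M)
    (hP : ∀ i < L, ∀ x y : X, P.real {h | H.Separated ord h i x y} ≤ M / s ^ i * dist x y)
    (T : MGraph X) :
    Measurable (fun h : H.Idx → ℝ => (T.map (H.sepCost ord h)).sum) ∧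
    ∫⁻ h, ENNReal.ofReal (T.map (H.sepCost ord h)).sum ∂P ≤
      ENNReal.ofReal (L * M * weight T) := by
  induction T using Multiset.induction with
  | empty => simp
  | cons e T ih =>
    have hnn : ∀ h : H.Idx → ℝ, 0 ≤ (T.map (H.sepCost ord h)).sum := fun h =>
      Multiset.sum_nonneg fun z hz => by
        obtain ⟨e, -, rfl⟩ := Multiset.mem_map.1 hz
        exact sepCost_nonneg hs ord h e
    simp only [Multiset.map_cons, Multiset.sum_cons, weight_cons]
    refine ⟨(measurable_sepCost ord e).add ih.1, ?_⟩
    simp_rw [fun h => ENNReal.ofReal_add (sepCost_nonneg hs ord h e) (hnn h)]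
    rw [lintegral_add_left (measurable_sepCost ord e).ennreal_ofReal, mul_add,
      ENNReal.ofReal_add (mul_nonneg (by positivity) (edgeLen_nonneg e))
        (mul_nonneg (by positivity) (weight_nonneg T))]
    exact add_le_add (lintegral_sepCost_le hs hP e) ih.2

/-- A form of Markov's inequality that also covers a vanishing mean. -/
lemma half_le_prob {Ω : Type u} [MeasurableSpace Ω] {P : Measure Ω} [IsProbabilityMeasure P]
    {f : Ω → ENNReal} (hf : Measurable f) {m : ENNReal} (hm : m ≠ ⊤) (hint : ∫⁻ ω, f ω ∂P ≤ m) :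
    1 / 2 ≤ P {ω | f ω ≤ 2 * m} := by
  have hlt : P {ω | f ω ≤ 2 * m}ᶜ ≤ 1 / 2 := by
    rcases eq_or_ne m 0 with rfl | hm0
    · have h1 := (lintegral_eq_zero_iff hf).1 (le_antisymm hint zero_le)
      have h2 : P {ω | f ω ≤ 2 * 0}ᶜ = 0 := by
        refine measure_mono_null ?_ (ae_iff.1 h1)
        intro ω hω h0
        exact hω (by simpa using h0)
      rw [h2]
      exact zero_le
    · have h1 := (mul_meas_ge_le_lintegral hf (2 * m)).trans hint
      have h2 : P {ω | f ω ≤ 2 * m}ᶜ ≤ P {ω | 2 * m ≤ f ω} :=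
        measure_mono fun ω hω => (lt_of_not_ge (show ¬ f ω ≤ 2 * m from hω)).le
      rw [mul_comm 2 m, mul_assoc] at h1
      have h3 : 2 * P {ω | m * 2 ≤ f ω} ≤ 1 :=
        (ENNReal.mul_le_mul_iff_right hm0 hm).1 (by rwa [mul_one])
      rw [mul_comm m 2] at h3
      refine h2.trans ?_
      rw [ENNReal.le_div_iff_mul_le (by simp) (by simp), mul_comm]
      exact h3
  have hadd := measure_add_measure_compl (μ := P)
    (measurableSet_le hf (measurable_const (a := 2 * m)))
  rw [measure_univ] at hadd
  by_contra hcon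
  rw [not_le] at hcon
  have h5 : P {ω | f ω ≤ 2 * m} + P {ω | f ω ≤ 2 * m}ᶜ < 1 / 2 + 1 / 2 :=
    ENNReal.add_lt_add_of_lt_of_le (by simp) hcon hlt
  rw [hadd, ENNReal.add_halves] at h5
  exact lt_irrefl _ h5

end NetTree

namespace NetTree

variable {X : Type u} [MetricSpace X] [Fintype X] {s : ℝ} {L : ℕ} {H : NetTree X s L}

/-! ### The random construction -/

open Classical in
/-- The solution rerouted through portals. If some radius is not good, all edges are routed through
hubs, which keeps the number of active portals small at the expense of the weight. -/
noncomputable def randomReroute (H : NetTree X s L) (ord : ℕ → X → ℕ) (θ A : ℝ) (t : ℕ)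
    (T : MGraph X) (h : H.Idx → ℝ) : MGraph (Portal X) :=
  H.reroute θ (H.clusterOf ord h) (if h ∈ H.goodEvent T A then t else 0) T

lemma measurableSet_randomReroute (ord : ℕ → X → ℕ) (θ A : ℝ) (t : ℕ) (T : MGraph X) (B : ℝ) :
    MeasurableSet {h | portalWeight (H.randomReroute ord θ A t T h) ≤ B} := by
  refine measurableSet_of_sameBalls fun h h' hh hmem => ?_
  have hgood : h ∈ H.goodEvent T A ↔ h' ∈ H.goodEvent T A :=
    ⟨hh.mem_goodEvent, hh.symm.mem_goodEvent⟩
  have heq : H.randomReroute ord θ A t T h = H.randomReroute ord θ A t T h' := by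
    rw [randomReroute, randomReroute, hh.clusterOf_eq ord]
    by_cases hg : h ∈ H.goodEvent T A
    · rw [if_pos hg, if_pos (hgood.1 hg)]
    · rw [if_neg hg, if_neg (mt hgood.2 hg)]
  have h1 : portalWeight (H.randomReroute ord θ A t T h) ≤ B := hmem
  rwa [heq] at h1

lemma isLight_randomReroute {k θ ε A m r : ℝ} {t : ℕ} {ord : ℕ → X → ℕ} {T : MGraph X}
    (hs : 4 ≤ s) (hL : 1 ≤ L) (hX : ∀ x y : X, x ≠ y → 1 ≤ dist x y) (hD : DoublingDimLE X k)
    (hk : 0 ≤ k) (hord : ∀ i ≤ L, Set.InjOn (ord i) (H.N i : Set X)) (hθ : 0 < θ) (hθ1 : θ ≤ 1)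
    (hε : 0 < ε) (hε1 : ε ≤ 1) (hA : 0 ≤ A) (hT : H.NetRespecting ε T)
    (hm : (48 * (s / θ)) ^ k ≤ m) (hr : t * (56 ^ k * A) + (1 + (48 * (s / ε)) ^ k) ≤ r)
    {h : H.Idx → ℝ} (hh : H.Admissible h) :
    H.IsLight θ ord h m r (H.randomReroute ord θ A t T h) := by
  refine ⟨portalRespecting_reroute hs hh hθ hθ1 hL T, ?_⟩
  rintro i C hC
  have hbound : ((H.activeSet ord h (H.randomReroute ord θ A t T h) i C).ncard : ℝ) ≤ r := by
    rw [randomReroute]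
    split_ifs with hgood
    · exact (activeSet_ncard_le hs hX hD hk hh hord hε hε1 hA hT hgood hC).trans hr
    · have h1 := activeSet_ncard_le_one (T := T) (θ := θ) (ord := ord) hs hh i C
      have h2 : ((H.activeSet ord h (H.reroute θ (H.clusterOf ord h) 0 T) i C).ncard : ℝ) ≤ 1 := by
        exact_mod_cast h1
      have h3 : 0 ≤ t * (56 ^ k * A) := by positivity
      have h4 : 0 ≤ (48 * (s / ε)) ^ k := by positivity
      linarith
  refine ⟨portalNodes_finite hs hθ i C, ?_, activeSet_finite i C, hbound⟩
  obtain ⟨hi, x, rfl⟩ := hC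
  exact (portalNodes_ncard_le hs hX hD hk hh hθ hθ1 hi x).trans hm

/-- The allowed values of the radii: those that cut few edges, at heights at least `1`. -/
def goodRadii (H : NetTree X s L) (T : MGraph X) (A : ℝ) (p : H.Idx) : Set ℝ :=
  if 1 ≤ (p.1 : ℕ) then goodShifts T (s ^ (p.1 : ℕ)) p.2.1 A else Set.univ

lemma goodEvent_eq_pi (T : MGraph X) (A : ℝ) :
    H.goodEvent T A = Set.pi Set.univ (H.goodRadii T A) := by
  ext h
  constructor
  · rintro hh ⟨⟨i, hi⟩, ⟨u, hu⟩⟩ -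
    rw [goodRadii]
    split_ifs with h1
    · have := hh i h1 (by omega) u hu
      rwa [H.radius_eq h hi hu] at this
    · trivial
  · intro hh i h1 h2 u hu
    have := hh ⟨⟨i, by omega⟩, ⟨u, hu⟩⟩ trivial
    rw [goodRadii, if_pos (by exact h1)] at this
    rw [H.radius_eq h (by omega) hu]
    exact this

/-- The detours of the rerouted solution are `O(ε)` times its weight with probability at least
`1 / 2`, by Markov's inequality. -/
lemma prob_randomReroute {k b a θ q : ℝ} {t : ℕ} {ord : ℕ → X → ℕ} {T : MGraph X} (hs : 4 ≤ s)
    (hL : 1 ≤ L) (hX : ∀ x y : X, x ≠ y → 1 ≤ dist x y) (hD : DoublingDimLE X k) (hk : 1 ≤ k)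
    (hord : ∀ i ≤ L, Set.InjOn (ord i) (H.N i : Set X)) (hθ : 0 < θ) (hθ1 : θ ≤ 1)
    (ht : 1 ≤ θ * s ^ t) (hb : 32 ≤ b) (ha : 2 * Real.log b ≤ a) (hq : 0 ≤ q)
    (hT : H.Sparse q T) :
    1 / 2 ≤ (cond (H.radiiLaw (b ^ k)) (H.goodEvent T (a * (q * k))))
      {h | portalWeight (H.randomReroute ord θ (a * (q * k)) t T h) ≤
        (1 + 1440 * Real.log b * (θ * (k * L))) * weight T} := by
  have hk0 : 0 < k := by linarith
  have hlogb : 0 < Real.log b := Real.log_pos (by linarith)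
  have ha0 : 0 < a := by linarith
  have h32 : b ≤ b ^ k := by
    simpa using Real.rpow_le_rpow_of_exponent_le (by linarith : 1 ≤ b) hk
  have hχ4 : 4 ≤ b ^ k := by linarith
  have hlogχ : Real.log (b ^ k) = k * Real.log b := Real.log_rpow (by linarith) k
  set A := a * (q * k)
  let G := H.goodRadii T A
  let δ : H.Idx → ℝ := fun p => s ^ (p.1 : ℕ) / (a * k)
  have hσ : ∀ p : H.Idx, 0 < s ^ (p.1 : ℕ) := fun p => by positivity
  have hG : ∀ p, MeasurableSet (G p) := by
    intro p
    simp only [G, goodRadii]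
    split_ifs
    · exact measurableSet_goodShifts _ _ _ _
    · exact MeasurableSet.univ
  have hδ0 : ∀ p, 0 ≤ δ p := fun p => by positivity
  -- removing the bad radii changes the exponent `log χ / s ^ i` by at most `log b / a`
  have hδ : ∀ p : H.Idx, Real.log (b ^ k) / s ^ (p.1 : ℕ) * δ p ≤ 1 / 2 := by
    intro p
    have h1 := hσ p
    have : Real.log (b ^ k) / s ^ (p.1 : ℕ) * δ p = Real.log b / a := by
      simp only [δ, hlogχ]
      field_simp
    rw [this, div_le_iff₀ ha0]
    linarith
  have hvol : ∀ p : H.Idx, volume (Set.Icc 0 (s ^ (p.1 : ℕ)) \ G p) ≤ ENNReal.ofReal (δ p) := by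
    intro p
    simp only [G, goodRadii]
    split_ifs with h1
    · have := volume_bad_le (F := T) (A := a * k) (u := p.2.1) (hσ p) hq (by positivity)
        (hT p.1 h1 (by omega) p.2.1 p.2.2)
      rwa [show a * k * q = A by simp only [A]; ring] at this
    · simp
  have hprob : ∀ p : H.Idx, IsProbabilityMeasure (truncExp (b ^ k) (s ^ (p.1 : ℕ))) := fun p =>
    isProbabilityMeasure_truncExp (by linarith) (hσ p)
  have hG0 : ∀ p : H.Idx, truncExp (b ^ k) (s ^ (p.1 : ℕ)) (G p) ≠ 0 := by
    intro p h0
    have h1 := truncExp_good_ge hχ4 (hσ p) (hG p) (hδ0 p) (hδ p) (hvol p)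
    rw [measureReal_def, h0, ENNReal.toReal_zero] at h1
    norm_num at h1
  have hprob' : ∀ p : H.Idx, IsProbabilityMeasure
      (cond (truncExp (b ^ k) (s ^ (p.1 : ℕ))) (G p)) := fun p =>
    cond_isProbabilityMeasure (hG0 p)
  have hpi := cond_pi (fun p : H.Idx => truncExp (b ^ k) (s ^ (p.1 : ℕ))) hG hG0
  have hgood : ∀ᵐ h ∂(Measure.pi fun p : H.Idx => cond (truncExp (b ^ k) (s ^ (p.1 : ℕ))) (G p)),
      h ∈ H.goodEvent T A := by
    rw [← hpi, goodEvent_eq_pi]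
    exact ae_cond_mem (MeasurableSet.univ_pi hG)
  have hadm : ∀ᵐ h ∂(Measure.pi fun p : H.Idx => cond (truncExp (b ^ k) (s ^ (p.1 : ℕ))) (G p)),
      H.Admissible h := by
    refine Filter.eventually_all.2 fun p => ?_
    have h1 : ∀ᵐ τ ∂(cond (truncExp (b ^ k) (s ^ (p.1 : ℕ))) (G p)),
        τ ∈ Set.Icc 0 (s ^ (p.1 : ℕ)) :=
      (cond_absolutelyContinuous).ae_le truncExp_compl_Icc
    exact (Measure.tendsto_eval_ae_ae (i := p)).eventually h1
  rw [radiiLaw, goodEvent_eq_pi, hpi]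
  set P := Measure.pi fun p : H.Idx => cond (truncExp (b ^ k) (s ^ (p.1 : ℕ))) (G p) with hP
  have hM : 0 ≤ 18 * (k * Real.log b) := by positivity
  have hsep : ∀ i < L, ∀ x y : X,
      P.real {h | H.Separated ord h i x y} ≤ 18 * (k * Real.log b) / s ^ i * dist x y := by
    intro i hi x y
    refine (prob_separated_le hs hX hD hk hb hord hG hδ0 hδ hvol hadm hi.le x y).trans_eq ?_
    rw [hlogχ]
    ring
  obtain ⟨hmeas, hint⟩ := lintegral_sum_sepCost_le hs hM hsep T
  refine (half_le_prob hmeas.ennreal_ofReal ENNReal.ofReal_ne_top hint).trans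
    (measure_mono_ae ?_)
  filter_upwards [hadm, hgood] with h hh hgh hle
  have hw := weight_nonneg T
  have hle' : ENNReal.ofReal (T.map (H.sepCost ord h)).sum ≤
      2 * ENNReal.ofReal (L * (18 * (k * Real.log b)) * weight T) := hle
  rw [← ENNReal.ofReal_ofNat, ← ENNReal.ofReal_mul (by norm_num),
    ENNReal.ofReal_le_ofReal_iff (by positivity)] at hle'
  change portalWeight (H.randomReroute ord θ A t T h) ≤ _
  rw [randomReroute, if_pos hgh]
  refine (portalWeight_reroute_le hs hh hord hθ hθ1 ht T).trans ?_
  calc _ ≤ weight T + 40 * θ * (2 * (L * (18 * (k * Real.log b)) * weight T)) := by gcongr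
    _ = _ := by ring

end NetTree

/-! ### The choice of the constants -/

/-- With `ℓ = log n`, the condition `s = ℓ ^ (c / k) ≥ 4` keeps both `k` and the number of heights
at most of the order of `ℓ`. -/
lemma le_log_and_le_logb {c c₁ k s ℓ : ℝ} (hc1 : c < 1) (hk : 1 ≤ k) (hℓ : 1 ≤ ℓ)
    (hs : s = ℓ ^ (c / k)) (hs4 : 4 ≤ s) (hc₁ : 0 < c₁) {L : ℝ}
    (hL : L ≤ c₁ * (ℓ / Real.log s)) : k ≤ ℓ ∧ L ≤ c₁ * ℓ := by
  have hk0 : 0 < k := by linarith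
  have hlogs : 1 ≤ Real.log s := by
    rw [Real.le_log_iff_exp_le (by linarith)]
    linarith [Real.exp_one_lt_d9]
  constructor
  · have h1 : Real.log s = c / k * Real.log ℓ := by rw [hs, Real.log_rpow (by linarith)]
    have h2 : 0 ≤ Real.log ℓ := Real.log_nonneg hℓ
    have h3 : Real.log ℓ ≤ ℓ - 1 := Real.log_le_sub_one_of_pos (by linarith)
    rw [h1, div_mul_eq_mul_div, le_div_iff₀ hk0] at hlogs
    nlinarith
  · refine hL.trans ?_
    gcongr
    exact div_le_self (by linarith) hlogs

/-- The number of active portals that short edges contribute is `q` times an exponential in `k`. -/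
lemma short_bound {k a q B t : ℝ} (hk : 1 ≤ k) (ha : 0 ≤ a) (hq : 0 ≤ q)
    (ht : t ≤ B * k) : t * (56 ^ k * (a * (q * k))) ≤ q * (224 * max 1 (B * a)) ^ k := by
  have hk0 : 0 < k := by linarith
  have h1 : k ≤ 2 ^ k := by
    have := one_add_mul_self_le_rpow_one_add (by norm_num : (-1 : ℝ) ≤ 1) hk
    norm_num at this
    linarith
  have h2 : k * k ≤ 4 ^ k := by
    rw [show (4 : ℝ) = 2 * 2 by norm_num, Real.mul_rpow (by norm_num) (by norm_num)]
    gcongr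
  have h3 : B * a ≤ max 1 (B * a) ^ k := by
    refine (le_max_right 1 _).trans ?_
    simpa using Real.rpow_le_rpow_of_exponent_le (le_max_left 1 (B * a)) hk
  have h4 : 0 ≤ max 1 (B * a) ^ k := by positivity
  have h5 : (224 * max 1 (B * a)) ^ k = 4 ^ k * 56 ^ k * max 1 (B * a) ^ k := by
    rw [← Real.mul_rpow (by norm_num) (by norm_num), ← Real.mul_rpow (by norm_num) (by positivity)]
    norm_num
  calc t * (56 ^ k * (a * (q * k))) ≤ B * k * (56 ^ k * (a * (q * k))) := by gcongr
    _ = q * (k * k * 56 ^ k * (B * a)) := by ring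
    _ ≤ q * (k * k * 56 ^ k * max 1 (B * a) ^ k) := by gcongr
    _ ≤ q * (4 ^ k * 56 ^ k * max 1 (B * a) ^ k) := by gcongr
    _ = _ := by rw [h5]

lemma long_bound {k x : ℝ} (hk : 1 ≤ k) (hx : 1 ≤ x) :
    1 + (48 * x) ^ k ≤ (96 * x) ^ k := by
  have h1 : (1 : ℝ) ≤ (48 * x) ^ k := Real.one_le_rpow (by linarith) (by linarith)
  have h2 : (2 : ℝ) ≤ 2 ^ k := by
    simpa using Real.rpow_le_rpow_of_exponent_le (by norm_num : (1 : ℝ) ≤ 2) hk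
  rw [show 96 * x = 2 * (48 * x) by ring,
    Real.mul_rpow (x := 2) (y := 48 * x) (by norm_num) (by linarith)]
  nlinarith

end SparseStruct

open SparseStruct NetTree

theorem mainTheorem2 :
    ∃ b₀ : ℝ, 1 < b₀ ∧ ∀ b : ℝ, b₀ ≤ b →
    ∃ a₀ : ℝ, 0 < a₀ ∧ ∀ a : ℝ, a₀ ≤ a →
    ∀ c : ℝ, 0 < c → c < 1 → ∀ c₁ : ℝ, 0 < c₁ → ∀ c₂ : ℝ, 0 < c₂ → c₂ ≤ 1 →
    ∃ C₁ C₂ C₃ C₄ : ℝ, 0 < C₁ ∧ 0 < C₂ ∧ 0 < C₃ ∧ 0 < C₄ ∧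
    ∀ ε : ℝ, 0 < ε → ε ≤ 1 → ∃ n₀ : ℕ, ∀ n : ℕ, n₀ ≤ n →
    ∀ (k s : ℝ) (L : ℕ), 1 ≤ k → s = Real.log n ^ (c / k) → 4 ≤ s →
      1 ≤ L → (L : ℝ) ≤ c₁ * Real.logb s n →
    ∀ (X : Type u) [MetricSpace X] [Fintype X], SparseStruct.DoublingDimLE X k →
      (∀ x y : X, x ≠ y → 1 ≤ dist x y) →
    ∀ (H : SparseStruct.NetTree X s L) (ord : ℕ → X → ℕ),
      (∀ i ≤ L, Set.InjOn (ord i) (H.N i : Set X)) →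
    ∀ (K : SparseStruct.Kind) (I : SparseStruct.PCInstance X), I.terminals.card ≤ n →
    ∀ (q : ℝ) (T : SparseStruct.MGraph X), H.OptNetRespecting K I ε T → H.Sparse q T →
    ∃ T' : (H.Idx → ℝ) → SparseStruct.MGraph (SparseStruct.Portal X),
      (∀ h : H.Idx → ℝ, H.Admissible h →
        H.IsLight (c₂ * (ε / (k * L))) ord h
          ((C₁ * (k * L * s / ε)) ^ k) (q * C₂ ^ k + (C₃ * (s / ε)) ^ k) (T' h) ∧
        SparseStruct.IsConn (T' h) ∧
        (∀ t ∈ I.terminals, t ∈ SparseStruct.verts T → SparseStruct.Visits (T' h) t) ∧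
        (SparseStruct.IsEulerian T → SparseStruct.IsEulerian (T' h))) ∧
      MeasurableSet
        {h | SparseStruct.portalWeight (T' h) ≤ (1 + C₄ * ε) * SparseStruct.weight T} ∧
      1 / 4 ≤ (ProbabilityTheory.cond (H.radiiLaw (b ^ k)) (H.goodEvent T (a * (q * k))))
        {h | SparseStruct.portalWeight (T' h) ≤ (1 + C₄ * ε) * SparseStruct.weight T} := by
  refine ⟨32, by norm_num, fun b hb => ?_⟩
  have hlogb : 0 < Real.log b := Real.log_pos (by linarith)
  refine ⟨2 * Real.log b, by positivity, fun a ha c hc hc1 c₁ hc₁ c₂ hc₂ hc₂1 => ?_⟩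
  have ha0 : 0 < a := by linarith
  refine ⟨48 / c₂, 224 * max 1 ((3 / c + 1) * a), 96, 1440 * Real.log b, by positivity,
    by positivity, by norm_num, by positivity, fun ε hε hε1 => ?_⟩
  refine ⟨⌈Real.exp (max 1 (c₁ / (c₂ * ε)))⌉₊, ?_⟩
  intro n hn k s L hk hs hs4 hL hLn X _ _ hD hX H ord hord K I _ q T hT hsparse
  have hk0 : 0 < k := by linarith
  have hL1 : (1 : ℝ) ≤ L := by exact_mod_cast hL
  have hL0 : (0 : ℝ) < L := by linarith
  -- `n` is so large that `1 / θ ≤ (log n) ^ 3`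
  have hexp : Real.exp (max 1 (c₁ / (c₂ * ε))) ≤ n := Nat.ceil_le.1 hn
  have hn0 : (0 : ℝ) < n := (Real.exp_pos _).trans_le hexp
  set ℓ := Real.log n
  have hℓ : max 1 (c₁ / (c₂ * ε)) ≤ ℓ := (Real.le_log_iff_exp_le hn0).2 hexp
  have hℓ1 : 1 ≤ ℓ := (le_max_left _ _).trans hℓ
  have hℓ0 : 0 < ℓ := by linarith
  obtain ⟨hkℓ, hLℓ⟩ := le_log_and_le_logb hc1 hk hℓ1 hs hs4 hc₁ hLn
  set θ := c₂ * (ε / (k * L))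
  have hθ : 0 < θ := by positivity
  have hkL : 1 ≤ k * L := by nlinarith
  have hθ1 : θ ≤ 1 := by
    have h1 : ε / (k * L) ≤ 1 := by rw [div_le_one (by positivity)]; linarith
    exact mul_le_one₀ hc₂1 (by positivity) h1
  have hθ3 : 1 ≤ θ * ℓ ^ 3 := by
    have h1 : c₁ ≤ ℓ * (c₂ * ε) := by
      rw [← div_le_iff₀ (by positivity)]
      exact (le_max_right _ _).trans hℓ
    have h2 : k * L ≤ ℓ * (ℓ * (c₂ * ε) * ℓ) := by
      calc k * L ≤ ℓ * (c₁ * ℓ) := by gcongr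
        _ ≤ _ := by gcongr
    have h3 : θ * ℓ ^ 3 = ℓ * (ℓ * (c₂ * ε) * ℓ) / (k * L) := by
      simp only [θ]
      ring
    rw [h3, le_div_iff₀ (by positivity)]
    linarith
  -- `s ^ (3 k / c) = (log n) ^ 3`, so that `O(k)` heights suffice to go from `θ` to `1`
  set t := ⌈3 * k / c⌉₊
  have ht : 1 ≤ θ * s ^ t := by
    refine hθ3.trans ?_
    gcongr
    calc ℓ ^ 3 = s ^ (3 * k / c) := by
          rw [hs, ← Real.rpow_mul hℓ0.le, ← Real.rpow_natCast]
          congr 1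
          field_simp
          norm_num
      _ ≤ s ^ (t : ℝ) := Real.rpow_le_rpow_of_exponent_le (by linarith) (Nat.le_ceil _)
      _ = s ^ t := Real.rpow_natCast s t
  have htk : (t : ℝ) ≤ (3 / c + 1) * k := by
    have h1 := (Nat.ceil_lt_add_one (by positivity : 0 ≤ 3 * k / c)).le
    calc (t : ℝ) ≤ 3 * k / c + 1 := h1
      _ ≤ 3 * k / c + k := by gcongr
      _ = _ := by ring
  have hq : 0 ≤ q := by
    obtain ⟨u, hu⟩ := Finset.card_pos.1 (H.top.symm ▸ one_pos : 0 < (H.N L).card)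
    have h1 := (weight_nonneg _).trans (hsparse L hL le_rfl u hu)
    exact nonneg_of_mul_nonneg_left h1 (by positivity)
  have hTconn : IsConn T := by
    have := hT.1.2
    cases K with
    | tsp => exact IsEulerian.isConn this
    | stp => exact this
  have hC4 : 1440 * Real.log b * (θ * (k * L)) ≤ 1440 * Real.log b * ε := by
    gcongr
    calc θ * (k * L) = c₂ * ε := by simp only [θ]; field_simp
      _ ≤ ε := mul_le_of_le_one_left hε.le hc₂1
  have hse : 1 ≤ s / ε := by rw [le_div_iff₀ hε]; linarith
  refine ⟨H.randomReroute ord θ (a * (q * k)) t T, fun h hh => ⟨?_, ?_, ?_, ?_⟩,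
    measurableSet_randomReroute _ _ _ _ _ _, ?_⟩
  · refine isLight_randomReroute hs4 hL hX hD hk0.le hord hθ hθ1 hε hε1 (by positivity) hT.2.1
      (le_of_eq ?_) (add_le_add (short_bound hk ha0.le hq htk)
        (long_bound hk hse)) hh
    congr 1
    simp only [θ]
    field_simp
  · exact hTconn.bind (H.route_trail θ _ _) (H.route_ne_zero θ _ _)
  · exact fun x _ hx => H.visits_reroute hx
  · exact fun hE => hE.bind (H.route_trail θ _ _) (H.route_ne_zero θ _ _)
  · refine le_trans ?_ ((prob_randomReroute (t := t) (ord := ord) hs4 hL hX hD hk hord hθ hθ1 ht hb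
      ha hq hsparse).trans (measure_mono fun h (hle : portalWeight _ ≤ _) =>
      show portalWeight _ ≤ _ from hle.trans ?_))
    · rw [one_div, one_div]
      exact ENNReal.inv_le_inv.2 (by norm_num)
    · exact mul_le_mul_of_nonneg_right (by linarith) (weight_nonneg T)
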